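/- Let $k\ge 2$ be an integer and let $G$ be a finite simple graph of order $n$ with at least one edge. Let $\mu_1\ge\mu_2\ge\cdots\ge\mu_n=0$ be the eigenvalues, with multiplicity, of the Laplacian matrix $L(G)=D(G)-A(G)$, where $D(G)$ is the diagonal matrix of vertex degrees and $A(G)$ the adjacency matrix of $G$. If $$\mu_1\le\Big(k+\frac12\Big)\mu_{n-1},$$ then $G$ has a $\{K_{1,1},K_{1,2},\ldots,K_{1,k},\mathcal T(2k+1)\}$-factor, that is, a spanning subgraph each of whose connected components is isomorphic to one of the stars $K_{1,1},\ldots,K_{1,k}$ or to a tree in $\mathcal T(2k+1)$. Here $\mathcal T(2k+1)$ is the following class of trees. Write $\mathrm{Leaf}(R)$ for the set of vertices of degree one of a tree $R$. Let $R$ be a finite tree such that every $x\in V(R)\setminus \mathrm{Leaf}(R)$, with $\ell(x)$ denoting the number of leaves of $R$ adjacent to $x$ and $d(x)$ the degree of $x$ in $R-\mathrm{Leaf}(R)$, satisfies $d(x)\in\{1,3,\ldots,2k+1\}$ and $2\ell(x)+d(x)\le 2k+1$. Let $T_R$ be the tree obtained from $R$ by inserting a new vertex of degree $2$ into each edge of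 $R-\mathrm{Leaf}(R)$ and by adding, at every vertex $x$ of $R-\mathrm{Leaf}(R)$ with $d(x)=2r+1<2k+1$, exactly $k-r-\ell(x)$ new pendant edges. Then $\mathcal T(2k+1)$ is the set of all such trees $T_R$. -/

import Mathlib

universe u

namespace StarTreeFactor

section Tree

variable {W : Type u} (R : SimpleGraph W)

/-- The set of vertices of degree one. -/
def leaves : Set W := {x | (R.neighborSet x).ncard = 1}

/-- `R - Leaf(R)`. -/
abbrev core : SimpleGraph ↥(leaves R)ᶜ := R.induce (leaves R)ᶜ

/-- The degree of a vertex of `R - Leaf(R)` in `R - Leaf(R)`. -/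
noncomputable def coreDegree (x : ↥(leaves R)ᶜ) : ℕ := ((core R).neighborSet x).ncard

/-- The number of leaves of `R` adjacent to a vertex of `R - Leaf(R)`. -/
noncomputable def leafCount (x : ↥(leaves R)ᶜ) : ℕ := (R.neighborSet x ∩ leaves R).ncard

/-- The trees `R` from which the members of `𝒯(2k+1)` are built. -/
def IsBaseTree (k : ℕ) : Prop :=
  R.IsTree ∧ ∀ x : ↥(leaves R)ᶜ,
    (Odd (coreDegree R x) ∧ coreDegree R x ≤ 2 * k + 1) ∧
      2 * leafCount R x + coreDegree R x ≤ 2 * k + 1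

/-- The number of pendant edges added at `x`: with `coreDegree R x = 2r+1` it is
`k - r - leafCount R x` if `2r+1 < 2k+1`. For a base tree the subtraction does not truncate. -/
noncomputable def addedCount (k : ℕ) (x : ↥(leaves R)ᶜ) : ℕ :=
  if coreDegree R x < 2 * k + 1 then k - coreDegree R x / 2 - leafCount R x else 0

/-- The vertices of `T_R`: those of `R`, one for each edge of `R - Leaf(R)`, and the ends of the
added pendant edges. -/
inductive TVertex (k : ℕ) : Type u
  | old (w : W) : TVertex k
  | mid (e : (core R).edgeSet) : TVertex k
  | pendant (x : ↥(leaves R)ᶜ) (i : Fin (addedCount R k x)) : TVertex k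

/-- The edges of `T_R`, each listed in at least one direction: the edges of `R` that meet a leaf,
the two halves of each subdivided edge of `R - Leaf(R)`, and the added pendant edges. -/
inductive TRel (k : ℕ) : TVertex R k → TVertex R k → Prop
  | leafEdge (a b : W) (hab : R.Adj a b) (hb : b ∈ leaves R) : TRel k (.old a) (.old b)
  | half (x : ↥(leaves R)ᶜ) (e : (core R).edgeSet) (hx : x ∈ (e : Sym2 ↥(leaves R)ᶜ)) :
      TRel k (.old x) (.mid e)
  | pendantEdge (x : ↥(leaves R)ᶜ) (i : Fin (addedCount R k x)) :
      TRel k (.old x) (.pendant x i)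

/-- The tree `T_R`. -/
def treeOf (k : ℕ) : SimpleGraph (TVertex R k) := SimpleGraph.fromRel (TRel R k)

end Tree

/-- `H` is isomorphic to a member of `𝒯(2k+1)`. -/
def IsInT (k : ℕ) {W : Type u} (H : SimpleGraph W) : Prop :=
  ∃ (m : ℕ) (R : SimpleGraph (Fin m)), IsBaseTree R k ∧ Nonempty (H ≃g treeOf R k)

/-- `H` is isomorphic to a member of `{K_{1,1}, …, K_{1,k}} ∪ 𝒯(2k+1)`. -/
def IsStarOrInT (k : ℕ) {W : Type u} (H : SimpleGraph W) : Prop :=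
  (∃ j : ℕ, 1 ≤ j ∧ j ≤ k ∧ Nonempty (H ≃g completeBipartiteGraph (Fin 1) (Fin j))) ∨ IsInT k H

/-- `F` is a spanning subgraph of `G` each of whose connected components satisfies `P`. -/
def IsComponentFactor (P : ∀ {W : Type u}, SimpleGraph W → Prop) {V : Type u}
    (G F : SimpleGraph V) : Prop :=
  F ≤ G ∧ ∀ c : F.ConnectedComponent, P c.toSimpleGraph

/-- `G` has a `{K_{1,1}, …, K_{1,k}, 𝒯(2k+1)}`-factor. -/
def HasStarTreeFactor (k : ℕ) {V : Type u} (G : SimpleGraph V) : Prop :=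
  ∃ F : SimpleGraph V, IsComponentFactor (IsStarOrInT k) G F

/-- The Laplacian eigenvalues with multiplicity in non-increasing order, indexed from `0`: the
value at index `i` is `μ_{i+1}`. -/
noncomputable def lapEigenvalue {V : Type u} [Fintype V] [DecidableEq V] (G : SimpleGraph V)
    [DecidableRel G.Adj] (i : Fin (Fintype.card V)) : ℝ :=
  (SimpleGraph.isHermitian_lapMatrix ℝ G).eigenvalues₀ i

end StarTreeFactor

/-! The spectral hypothesis enters only through degrees. Expanding a diagonal entry of the Laplacian
in an orthonormal eigenbasis gives `deg v = ∑ λ_i b_i(v)^2`. Since `μ_{n-1} > 0`, the kernel is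
spanned by the constant vector, so the other weights at each vertex add up to `1 - 1/n` and `μ_{n-1}
(1 - 1/n) ≤ deg v ≤ μ_1 (1 - 1/n)`. Hence any two degrees have ratio at most `k + 1/2`
(`two_mul_degree_le`), and counting edges between a set `S` and the vertices isolated by deleting it
gives `2 iso(G - S) ≤ (2k+1)|S|` (`two_mul_card_isol_le`).

What remains is combinatorial (`hasStarTreeFactor_of_card_isol_le`). Take `S` maximizing `iso(G - S)
- k|S|` and let `I` be the set of vertices it isolates. By maximality, what is left outside `S ∪ I`
satisfies the star-factor condition `iso ≤ k|T|` and is covered by stars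
(`coverable_of_card_isol_le`).

On `S ∪ I`, give every vertex of `I` two half-edges into `S`. Two Hall conditions, one from the
hypothesis and one from maximality, combine to make every load `2k` or `2k+1`. Among such
assignments take one with the fewest split vertices, those whose half-edges have different ends. Its
graph has no cycle, and loads are constant on components, since otherwise some split vertices could
be merged. A component of load `2k` is `K_{1,k}` by parity; one of load `2k+1` is a member of
`𝒯(2k+1)` whose split vertices are the subdividing vertices (`IsMinHalfAssignment.isPiece`,
`isInT_of_isTree`). -/

namespace StarTreeFactor

/-! ### Pieces of a factor and sets they cover -/

section Pieces

variable {V : Type u} {k : ℕ} {G : SimpleGraph V}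

/-- `X` is the vertex set of a possible component of a star-tree factor of `G`. -/
def IsPiece (k : ℕ) (G : SimpleGraph V) (X : Set V) : Prop :=
  ∃ H : SimpleGraph V, H ≤ G ∧ (H.induce X).Connected ∧ IsStarOrInT k (H.induce X)

/-- `A` is a disjoint union of vertex sets of possible components of a star-tree factor. -/
def Coverable (k : ℕ) (G : SimpleGraph V) (A : Set V) : Prop :=
  ∃ 𝒳 : Set (Set V), 𝒳.PairwiseDisjoint id ∧ ⋃₀ 𝒳 = A ∧ ∀ X ∈ 𝒳, IsPiece k G X

lemma Coverable.empty : Coverable k G ∅ := ⟨∅, by simp, by simp, by simp⟩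

lemma IsPiece.coverable {X : Set V} (h : IsPiece k G X) : Coverable k G X :=
  ⟨{X}, by simp, by simp, by simpa using h⟩

lemma Coverable.union {A B : Set V} (hA : Coverable k G A) (hB : Coverable k G B)
    (hAB : Disjoint A B) : Coverable k G (A ∪ B) := by
  obtain ⟨𝒳, hd, rfl, hp⟩ := hA
  obtain ⟨𝒴, hd', rfl, hp'⟩ := hB
  refine ⟨𝒳 ∪ 𝒴, ?_, Set.sUnion_union _ _, ?_⟩
  · refine hd.union hd' fun X hX Y hY _ => ?_
    exact hAB.mono (Set.subset_sUnion_of_mem hX) (Set.subset_sUnion_of_mem hY)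
  · rintro X (hX | hX)
    exacts [hp X hX, hp' X hX]

/-- Repetitions in the family are allowed, so that components may be indexed by their vertices in
`S`. -/
lemma coverable_iUnion {ι : Type*} {X : ι → Set V}
    (hX : ∀ i, IsPiece k G (X i)) (hd : ∀ i j, (X i ∩ X j).Nonempty → X i = X j) :
    Coverable k G (⋃ i, X i) := by
  refine ⟨Set.range X, ?_, Set.sUnion_range X, by simpa using hX⟩
  rintro _ ⟨i, rfl⟩ _ ⟨j, rfl⟩ hij
  rw [Function.onFun, Set.disjoint_iff_inter_eq_empty]
  by_contra h
  exact hij (hd i j (Set.nonempty_iff_ne_empty.2 h))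

/-- Keep only the edges of each witness graph inside its own piece: no edge leaves a piece and each
piece is connected, so the pieces are exactly the components. -/
lemma Coverable.hasStarTreeFactor (h : Coverable k G Set.univ) : HasStarTreeFactor k G := by
  obtain ⟨𝒳, hd, hu, hp⟩ := h
  choose! H hHG hc hs using hp
  let F : SimpleGraph V :=
    { Adj := fun u v => ∃ X ∈ 𝒳, u ∈ X ∧ v ∈ X ∧ (H X).Adj u v
      symm := ⟨fun u v ⟨X, hX, h1, h2, h3⟩ => ⟨X, hX, h2, h1, h3.symm⟩⟩
      loopless := ⟨fun u ⟨X, _, _, _, h3⟩ => (H X).loopless.irrefl u h3⟩ }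
  have huniq : ∀ X ∈ 𝒳, ∀ Y ∈ 𝒳, ∀ u, u ∈ X → u ∈ Y → X = Y := fun X hX Y hY u h1 h2 =>
    hd.elim_set hX hY u h1 h2
  refine ⟨F, fun u v ⟨X, hX, _, _, h⟩ => hHG X hX h, fun c => ?_⟩
  induction c using SimpleGraph.ConnectedComponent.ind with | _ v => ?_
  obtain ⟨X, hX, hv⟩ : v ∈ ⋃₀ 𝒳 := by rw [hu]; trivial
  have hind : F.induce X = (H X).induce X := by
    ext ⟨a, ha⟩ ⟨b, hb⟩
    simp only [SimpleGraph.comap_adj, Function.Embedding.subtype_apply]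
    constructor
    · rintro ⟨Y, hY, h1, _, h3⟩
      rwa [huniq X hX Y hY a ha h1]
    · exact fun h => ⟨X, hX, ha, hb, h⟩
  have hsupp : (F.connectedComponentMk v).supp = X := by
    ext w
    rw [SimpleGraph.ConnectedComponent.mem_supp_iff, SimpleGraph.ConnectedComponent.eq]
    constructor
    · intro hw
      obtain ⟨p⟩ := hw.symm
      clear hw
      induction p with
      | nil => exact hv
      | cons hadj p ih =>
        obtain ⟨Y, hY, h1, h2, _⟩ := hadj
        exact ih (huniq X hX Y hY _ hv h1 ▸ h2)
    · intro hw
      have := (hind ▸ hc X hX : (F.induce X).Connected).preconnected ⟨w, hw⟩ ⟨v, hv⟩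
      simpa using this.map (SimpleGraph.Embedding.induce X).toHom
  have hP : ∀ Y : Set V, Y = X → IsStarOrInT k (F.induce Y) := by
    rintro _ rfl
    rw [hind]
    exact hs _ hX
  exact hP _ hsupp

lemma isPiece_star [DecidableEq V] {s : V} {L : Finset V} (hL : L.Nonempty) (hk : L.card ≤ k)
    (hadj : ∀ v ∈ L, G.Adj s v) : IsPiece k G (insert s (L : Set V)) := by
  have hsL : s ∉ L := fun h => G.loopless.irrefl s (hadj s h)
  let H : SimpleGraph V :=
    { Adj := fun u v => (u = s ∧ v ∈ L) ∨ (v = s ∧ u ∈ L)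
      symm := ⟨fun u v h => h.symm⟩
      loopless := ⟨fun u h => by rcases h with ⟨rfl, h⟩ | ⟨rfl, h⟩ <;> exact hsL h⟩ }
  refine ⟨H, ?_, ?_, Or.inl ⟨L.card, hL.card_pos, hk, ⟨?_⟩⟩⟩
  · rintro u v (⟨rfl, h⟩ | ⟨rfl, h⟩)
    exacts [hadj _ h, (hadj _ h).symm]
  · have hcen : ∀ x : ↥(insert s (L : Set V)),
        (H.induce (insert s (L : Set V))).Reachable ⟨s, by simp⟩ x := by
      rintro ⟨x, hx⟩
      rcases hx with rfl | hx
      · rfl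
      · exact SimpleGraph.Adj.reachable (Or.inl ⟨rfl, by simpa using hx⟩)
    have : Nonempty ↥(insert s (L : Set V)) := ⟨⟨s, by simp⟩⟩
    exact ⟨fun x y => (hcen x).symm.trans (hcen y)⟩
  · let e := L.equivFin
    refine ⟨⟨fun x => if h : x.1 ∈ L then Sum.inr (e ⟨x.1, h⟩) else Sum.inl 0,
      fun y => Sum.elim (fun _ => ⟨s, by simp⟩) (fun j => ⟨(e.symm j).1, by simp⟩) y, ?_, ?_⟩, ?_⟩
    · rintro ⟨x, hx⟩
      by_cases h : x ∈ L
      · simp [h]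
      · have : x = s := by simpa [h] using hx
        simp [this, hsL]
    · rintro (y | y)
      · simp [hsL, Subsingleton.elim (0 : Fin 1) y]
      · simp
    · rintro ⟨x, hx⟩ ⟨y, hy⟩
      by_cases h : x ∈ L <;> by_cases h' : y ∈ L
      · have h1 : x ≠ s := by rintro rfl; exact hsL h
        have h2 : y ≠ s := by rintro rfl; exact hsL h'
        simp [h, h', H, h1, h2]
      · have : y = s := by simpa [h'] using hy
        simp [h, this, hsL, H]
      · have : x = s := by simpa [h] using hx
        simp [h', this, hsL, H]
      · simp [h, h', H]

lemma coverable_star [DecidableEq V] {s : V} {L : Finset V} (hL : L.Nonempty) (hk : L.card ≤ k)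
    (hadj : ∀ v ∈ L, G.Adj s v) : Coverable k G (insert s (L : Set V)) :=
  (isPiece_star hL hk hadj).coverable

/-- Cut edges off the front of the path; a final stretch of three vertices is a `K_{1,2}`, which is
where `2 ≤ k` is needed. -/
lemma coverable_of_isChain [DecidableEq V] (hk : 2 ≤ k) : ∀ l : List V, l.IsChain G.Adj → l.Nodup →
    l.length ≠ 1 → Coverable k G {v | v ∈ l}
  | [], _, _, _ => by simpa using Coverable.empty
  | [_], _, _, h => absurd rfl h
  | a :: b :: l, hc, hn, hl => by
    by_cases h1 : l.length = 1
    · obtain ⟨c, rfl⟩ := List.length_eq_one_iff.1 h1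
      have h1 : G.Adj b a := by simp at hc; exact hc.1.symm
      have h2 : G.Adj b c := by simp at hc; exact hc.2
      have := coverable_star (k := k) (G := G) (s := b) (L := {a, c}) (by simp)
        (Finset.card_le_two.trans hk) (by simp [h1, h2])
      convert this using 1
      ext x
      simp only [List.mem_cons, List.not_mem_nil, or_false, Set.mem_ofPred_eq, Finset.coe_insert,
        Finset.coe_singleton, Set.mem_insert_iff, Set.mem_singleton_iff]
      tauto
    · rw [List.isChain_cons_cons] at hc
      have ih := coverable_of_isChain hk l hc.2.tail (by simp at hn; tauto) h1
      have hs := coverable_star (k := k) (G := G) (s := a) (L := {b}) (by simp)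
        (by simp; omega) (by simp [hc.1])
      have := hs.union ih (by
        rw [Set.disjoint_left]
        simp at hn ⊢
        tauto)
      convert this using 1
      ext x
      simp [or_assoc]

end Pieces

/-! ### From Laplacian eigenvalues to degree ratios -/

section Laplacian

variable {V : Type u} [Fintype V] [DecidableEq V] (G : SimpleGraph V) [DecidableRel G.Adj]

/-- The `v`-th coordinates of an orthonormal eigenbasis of the Laplacian matrix: together with the
eigenvalues they express the degree of `v`, and they have unit length. -/
lemma exists_lapMatrix_eigenbasis : ∃ b : Fin (Fintype.card V) → V → ℝ,
    (∀ v, (G.degree v : ℝ) = ∑ i, lapEigenvalue G i * b i v ^ 2) ∧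
    (∀ v w, ∑ i, b i v * b i w = if v = w then 1 else 0) ∧
    (∀ i, lapEigenvalue G i * ∑ v, b i v = 0) := by
  set hA := SimpleGraph.isHermitian_lapMatrix ℝ G with hAdef
  let e : Fin (Fintype.card V) ≃ V := Fintype.equivOfCardEq (Fintype.card_fin _)
  have hev : ∀ i, hA.eigenvalues (e i) = lapEigenvalue G i := fun i => by
    simp [Matrix.IsHermitian.eigenvalues, e, lapEigenvalue]
  refine ⟨fun i v => hA.eigenvectorBasis (e i) v, fun v => ?_, fun v w => ?_, fun i => ?_⟩
  · have h := congrFun (congrFun hA.spectral_theorem v) v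
    have hL : G.lapMatrix ℝ v v = G.degree v := by
      simp [SimpleGraph.lapMatrix, SimpleGraph.degMatrix]
    rw [hL] at h
    rw [h, Unitary.conjStarAlgAut_apply, Matrix.mul_apply]
    rw [← e.sum_comp]
    refine Finset.sum_congr rfl fun i _ => ?_
    rw [Matrix.mul_diagonal, Matrix.star_apply, Matrix.IsHermitian.eigenvectorUnitary_apply,
      Function.comp_apply, hev]
    simp
    ring
  · have h := congrFun (congrFun (Unitary.coe_mul_star_self hA.eigenvectorUnitary) v) w
    rw [Matrix.mul_apply, ← e.sum_comp] at h
    rw [Matrix.one_apply] at h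
    rw [← h]
    refine Finset.sum_congr rfl fun i _ => ?_
    simp [Unitary.coe_star, Matrix.star_apply]
  · have h := hA.mulVec_eigenvectorBasis (e i)
    have h1 := congrArg (fun x => (fun _ => (1 : ℝ)) ⬝ᵥ x) h
    simp only at h1
    rw [Matrix.dotProduct_mulVec, ← Matrix.mulVec_transpose,
      (SimpleGraph.isSymm_lapMatrix (R := ℝ) G).eq] at h1
    rw [SimpleGraph.lapMatrix_mulVec_const_eq_zero, zero_dotProduct, dotProduct_smul, hev] at h1
    simpa [dotProduct] using h1.symm

/-- Every degree is a combination of the nonzero eigenvalues with weights of total `1 - 1/n`, so it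
lies between `m (1 - 1/n)` and `M (1 - 1/n)`. -/
lemma two_mul_degree_le {k n : ℕ} (hn : Fintype.card V = n) (hn2 : 2 ≤ n)
    (hG : ∃ a b : V, G.Adj a b)
    (hμ : lapEigenvalue G ⟨1 - 1, by omega⟩ ≤
      ((k : ℝ) + 1 / 2) * lapEigenvalue G ⟨(n - 1) - 1, by omega⟩) (u v : V) :
    2 * G.degree u ≤ (2 * k + 1) * G.degree v := by
  obtain ⟨b, hdeg, horth, hker⟩ := exists_lapMatrix_eigenbasis G
  set M := lapEigenvalue G ⟨1 - 1, by omega⟩ with hM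
  set m := lapEigenvalue G ⟨(n - 1) - 1, by omega⟩ with hm
  have hanti : Antitone (lapEigenvalue G) :=
    (SimpleGraph.isHermitian_lapMatrix ℝ G).eigenvalues₀_antitone
  have hunit : ∀ v, ∑ i, b i v ^ 2 = 1 := fun v => by simpa [sq] using horth v v
  have hle : ∀ i, lapEigenvalue G i ≤ M := fun i => hanti (by simp [Fin.le_def])
  have hMpos : 0 < M := by
    obtain ⟨a, c, hac⟩ := hG
    have h1 : 0 < G.degree a := (G.degree_pos_iff_exists_adj a).2 ⟨c, hac⟩
    calc (0 : ℝ) < G.degree a := by exact_mod_cast h1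
      _ ≤ ∑ i, M * b i a ^ 2 := by
        rw [hdeg a]
        gcongr
        exact hle _
      _ = M := by rw [← Finset.mul_sum, hunit, mul_one]
  have hmpos : 0 < m := by
    by_contra h
    have h1 : ((k : ℝ) + 1 / 2) * m ≤ 0 :=
      mul_nonpos_of_nonneg_of_nonpos (by positivity) (by linarith)
    linarith
  let l : Fin (Fintype.card V) := ⟨n - 1, by omega⟩
  have hge : ∀ i, i ≠ l → m ≤ lapEigenvalue G i := fun i hi => hanti (by
    have := i.2
    have h2 : i.1 ≠ n - 1 := fun h => hi (Fin.ext h)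
    simp only [Fin.le_def]
    omega)
  have hsum : ∀ i, i ≠ l → ∑ v, b i v = 0 := fun i hi =>
    (mul_eq_zero.1 (hker i)).resolve_left (hmpos.trans_le (hge i hi)).ne'
  -- Summing the orthonormality relations over `w` kills every index but `l`; hence the last
  -- eigenvector is constant.
  have hl1 : ∀ v, b l v * ∑ w, b l w = 1 := fun v => by
    have h1 : ∑ w, ∑ i, b i v * b i w = 1 := by simp [horth]
    rw [Finset.sum_comm] at h1
    simp_rw [← Finset.mul_sum] at h1
    rwa [Finset.sum_eq_single l (fun i _ hi => by rw [hsum i hi, mul_zero]) (by simp)] at h1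
  set t := ∑ w, b l w with ht
  have hn0 : (0 : ℝ) < n := by exact_mod_cast (by omega : 0 < n)
  have ht2 : t ^ 2 = n := by
    have : ∑ v, b l v * t = n := by simp [hl1, hn]
    rw [← Finset.sum_mul] at this
    rw [sq, ← this]
  have hlsq : ∀ v, b l v ^ 2 = 1 / n := fun v => by
    rw [eq_div_iff hn0.ne', ← ht2, ← mul_pow, hl1, one_pow]
  have hlz : lapEigenvalue G l = 0 := by
    refine (mul_eq_zero.1 (hker l)).resolve_right fun h => ?_
    rw [← ht] at h
    rw [h] at ht2
    simp at ht2
    linarith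
  have hrest : ∀ v, ∑ i ∈ Finset.univ.erase l, b i v ^ 2 = 1 - 1 / n := fun v => by
    have := hunit v
    rw [← Finset.add_sum_erase _ _ (Finset.mem_univ l), hlsq] at this
    linarith
  have hdeg' : ∀ v, (G.degree v : ℝ) =
      ∑ i ∈ Finset.univ.erase l, lapEigenvalue G i * b i v ^ 2 := fun v => by
    rw [hdeg v, ← Finset.add_sum_erase _ _ (Finset.mem_univ l), hlz]
    ring
  have hup : (G.degree u : ℝ) ≤ M * (1 - 1 / n) := by
    rw [hdeg' u, ← hrest u, Finset.mul_sum]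
    gcongr
    exact hle _
  have hlow : m * (1 - 1 / n) ≤ (G.degree v : ℝ) := by
    rw [hdeg' v, ← hrest v, Finset.mul_sum]
    gcongr with i hi
    exact hge i (Finset.ne_of_mem_erase hi)
  have hn1 : (0 : ℝ) ≤ 1 - 1 / n := by
    rw [sub_nonneg, div_le_one hn0]
    exact_mod_cast (by omega : 1 ≤ n)
  have : 2 * (G.degree u : ℝ) ≤ (2 * k + 1) * G.degree v := by
    calc 2 * (G.degree u : ℝ) ≤ 2 * (M * (1 - 1 / n)) := by linarith
      _ ≤ 2 * ((((k : ℝ) + 1 / 2) * m) * (1 - 1 / n)) := by gcongr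
      _ = (2 * k + 1) * (m * (1 - 1 / n)) := by ring
      _ ≤ _ := by gcongr
  exact_mod_cast this

end Laplacian

/-! ### Counting isolated vertices -/

section Isolated

variable {V : Type u} [Fintype V] [DecidableEq V] (G : SimpleGraph V) [DecidableRel G.Adj]

/-- The isolated vertices of `G[D] - S`. -/
def isol (D S : Finset V) : Finset V := {v ∈ D | v ∉ S ∧ ∀ w ∈ D, G.Adj v w → w ∈ S}

variable {G}

lemma mem_isol {D S : Finset V} {v : V} :
    v ∈ isol G D S ↔ v ∈ D ∧ v ∉ S ∧ ∀ w ∈ D, G.Adj v w → w ∈ S := by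
  simp [isol]

/-- All edges at an isolated vertex end in `S`, so the degree sum over `I` is at most that over `S`.
Compare both with the least degree in `I`. -/
lemma two_mul_card_isol_le {k : ℕ} (hpos : ∀ v, 0 < G.degree v)
    (hdeg : ∀ u v, 2 * G.degree u ≤ (2 * k + 1) * G.degree v) (S : Finset V) :
    2 * (isol G Finset.univ S).card ≤ (2 * k + 1) * S.card := by
  set I := isol G Finset.univ S with hI
  rcases I.eq_empty_or_nonempty with h | ⟨v₀, hv₀⟩
  · simp [h]
  obtain ⟨v, hv, hmin⟩ := I.exists_min_image (fun w => G.degree w) ⟨v₀, hv₀⟩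
  have hcount : ∑ w ∈ I, G.degree w ≤ ∑ s ∈ S, G.degree s := by
    have h1 : ∀ w ∈ I, G.degree w = (S.filter (G.Adj w)).card := fun w hw => by
      rw [← G.card_neighborFinset_eq_degree]
      congr 1
      ext x
      simp only [SimpleGraph.mem_neighborFinset, Finset.mem_filter]
      exact ⟨fun h => ⟨(mem_isol.1 hw).2.2 x (Finset.mem_univ _) h, h⟩, fun h => h.2⟩
    rw [Finset.sum_congr rfl h1]
    have h2 := Finset.sum_card_bipartiteAbove_eq_sum_card_bipartiteBelow (s := I) (t := S) G.Adj
    simp only [Finset.bipartiteAbove, Finset.bipartiteBelow] at h2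
    rw [h2]
    refine Finset.sum_le_sum fun s _ => ?_
    rw [← G.card_neighborFinset_eq_degree]
    refine Finset.card_le_card fun x hx => ?_
    simp only [Finset.mem_filter] at hx
    simpa using hx.2.symm
  have h3 : I.card * G.degree v ≤ ∑ w ∈ I, G.degree w := by
    simpa using Finset.card_nsmul_le_sum I (fun w => G.degree w) (G.degree v) hmin
  have h4 : ∑ s ∈ S, 2 * G.degree s ≤ S.card * ((2 * k + 1) * G.degree v) := by
    simpa using Finset.sum_le_card_nsmul S (fun s => 2 * G.degree s) _ fun s _ => hdeg s v
  rw [← Finset.mul_sum] at h4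
  refine Nat.le_of_mul_le_mul_right ?_ (hpos v)
  nlinarith

end Isolated

/-! ### Assignments with prescribed lower and upper loads -/

section Assignment

/-- **Mendelsohn–Dulmage**: a matching covering `X` and a matching covering `Y₀` can be combined. -/
lemma exists_injective_covering {X Y : Type*} (r : X → Y → Prop) (Y₀ : Set Y)
    {φ : X → Y} (hφ : Function.Injective φ) (hφr : ∀ x, r x (φ x))
    {ψ : Y₀ → X} (hψ : Function.Injective ψ) (hψr : ∀ y, r (ψ y) y) :
    ∃ h : X → Y, Function.Injective h ∧ (∀ x, r x (h x)) ∧ ∀ y ∈ Y₀, ∃ x, h x = y := by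
  classical
  -- Padding both sides with `Y × ℕ` makes `φ` and `ψ` into two injections to which
  -- Schröder–Bernstein applies. The relation `R` forces real partners for `X` and forbids dummy
  -- partners for `Y₀`.
  let f : X ⊕ (Y × ℕ) → Y ⊕ (Y × ℕ) := Sum.map φ id
  let g : Y ⊕ (Y × ℕ) → X ⊕ (Y × ℕ) := Sum.elim
    (fun y => if hy : y ∈ Y₀ then Sum.inl (ψ ⟨y, hy⟩) else Sum.inr (y, 0))
    (fun z => Sum.inr (z.1, z.2 + 1))
  let R : X ⊕ (Y × ℕ) → Y ⊕ (Y × ℕ) → Prop := fun a b =>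
    Sum.elim (fun x => Sum.elim (fun y => r x y) (fun _ => False) b)
      (fun _ => Sum.elim (fun y => y ∉ Y₀) (fun _ => True) b) a
  have hf : Function.Injective f := hφ.sumMap Function.injective_id
  have hg : Function.Injective g := by
    rintro (y | ⟨y, n⟩) (y' | ⟨y', n'⟩) h
    · by_cases hy : y ∈ Y₀ <;> by_cases hy' : y' ∈ Y₀ <;> simp [g, hy, hy'] at h
      · simpa using hψ h
      · rw [h]
    · by_cases hy : y ∈ Y₀ <;> simp [g, hy] at h
    · by_cases hy : y' ∈ Y₀ <;> simp [g, hy] at h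
    · simpa [g] using h
  obtain ⟨h, hbij, hR⟩ := Function.Embedding.schroeder_bernstein_of_rel hf hg R
    (by rintro (x | z) <;> simp [R, f, hφr])
    (by
      rintro (y | z)
      · by_cases hy : y ∈ Y₀
        · simpa [R, g, hy] using hψr ⟨y, hy⟩
        · simp [R, g, hy]
      · simp [R, g])
  have hex : ∀ x, ∃ y, h (Sum.inl x) = Sum.inl y ∧ r x y := fun x => by
    have := hR (Sum.inl x)
    rcases hy : h (Sum.inl x) with y | z
    · exact ⟨y, rfl, by simpa [R, hy] using this⟩
    · simp [R, hy] at this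
  choose H hH hHr using hex
  refine ⟨H, fun x x' hx => ?_, hHr, fun y hy => ?_⟩
  · have := hbij.1 ((hH x).trans ((congrArg Sum.inl hx).trans (hH x').symm))
    simpa using this
  · obtain ⟨a, ha⟩ := hbij.2 (Sum.inl y)
    rcases a with x | z
    · exact ⟨x, by simpa using (hH x).symm.trans ha⟩
    · have := hR (Sum.inr z)
      simp [R, ha, hy] at this

/-- Hall's theorem for `p` copies of each `a` and `q` of each `b`: a set of copies has the same
neighbours as the full fibres over its projection, so only those need checking. -/
lemma exists_injective_copies {α β : Type*} [Fintype α] [Fintype β] (r : α → β → Prop) (p q : ℕ)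
    (h : ∀ A : Finset α, p * A.card ≤ q * {b | ∃ a ∈ A, r a b}.ncard) :
    ∃ φ : α × Fin p → β × Fin q, Function.Injective φ ∧ ∀ x, r x.1 (φ x).1 := by
  classical
  obtain ⟨φ, hφ, hr⟩ := (Finset.all_card_le_biUnion_card_iff_exists_injective
    (fun x : α × Fin p => (Finset.univ.filter fun b => r x.1 b) ×ˢ (Finset.univ : Finset (Fin q)))).1
    (fun A => by
      have h1 : A.card ≤ p * (A.image Prod.fst).card := by
        calc A.card ≤ ((A.image Prod.fst) ×ˢ (Finset.univ : Finset (Fin p))).card :=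
              Finset.card_le_card fun x hx => by simpa using ⟨x.2, hx⟩
          _ = _ := by rw [Finset.card_product, Finset.card_univ, Fintype.card_fin, mul_comm]
      refine h1.trans ((h _).trans (le_of_eq ?_))
      have h2 : (A.biUnion fun x => (Finset.univ.filter fun b => r x.1 b) ×ˢ
          (Finset.univ : Finset (Fin q))) =
          (Finset.univ.filter fun b => ∃ a ∈ A.image Prod.fst, r a b) ×ˢ Finset.univ := by
        ext ⟨b, j⟩
        simp
      rw [h2, Finset.card_product, Finset.card_univ, Fintype.card_fin, mul_comm]
      congr 1
      rw [← Set.ncard_coe_finset]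
      congr 1
      ext b
      simp)
  refine ⟨φ, hφ, fun x => ?_⟩
  have := hr x
  simp only [Finset.mem_product, Finset.mem_filter] at this
  exact this.1.2

variable {V : Type u} [DecidableEq V]

/-- The number of half-edges that the assignment `f` sends from `I` to `s`. -/
def load {p : ℕ} (I : Finset V) (f : V → Fin p → V) (s : V) : ℕ :=
  ∑ v ∈ I, (Finset.univ.filter fun j => f v j = s).card

/-- Each `s` offers `hi` slots. The first Hall condition places all half-edges in slots, the second
fills `lo` slots at every `s`, and Mendelsohn–Dulmage achieves both at once. -/
lemma exists_assignment [Fintype V] (r : V → V → Prop) (I S : Finset V) {p lo hi : ℕ}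
    (hlh : lo ≤ hi)
    (h1 : ∀ A ⊆ I, p * A.card ≤ hi * {s | s ∈ S ∧ ∃ v ∈ A, r v s}.ncard)
    (h2 : ∀ T ⊆ S, lo * T.card ≤ p * {v | v ∈ I ∧ ∃ s ∈ T, r v s}.ncard) :
    ∃ f : V → Fin p → V, (∀ v ∈ I, ∀ j, f v j ∈ S ∧ r v (f v j)) ∧
      ∀ s ∈ S, lo ≤ load I f s ∧ load I f s ≤ hi := by
  classical
  have hsub : ∀ (J T A : Finset V) (r' : V → V → Prop) (B : Finset ↥J),
      A = B.map (Function.Embedding.subtype _) →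
      {s | s ∈ T ∧ ∃ v ∈ A, r' v s}.ncard = {s : ↥T | ∃ v ∈ B, r' v s}.ncard := by
    rintro J T _ r' B rfl
    rw [← Set.ncard_image_of_injective _ (Subtype.val_injective (p := (· ∈ T)))]
    congr 1
    ext s
    simp [and_comm]
  obtain ⟨φ, hφ, hφr⟩ := exists_injective_copies (fun (v : ↥I) (s : ↥S) => r v s) p hi (fun B => by
    have := h1 (B.map (Function.Embedding.subtype _)) (fun x hx => by
      simp at hx; exact hx.1)
    rwa [hsub I S _ r B rfl, Finset.card_map] at this)
  obtain ⟨ψ, hψ, hψr⟩ := exists_injective_copies (fun (s : ↥S) (v : ↥I) => r v s) lo p (fun B => by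
    have := h2 (B.map (Function.Embedding.subtype _)) (fun x hx => by
      simp at hx; exact hx.1)
    rwa [hsub S I _ (fun s v => r v s) B rfl, Finset.card_map] at this)
  let Y₀ : Set (↥S × Fin hi) := {y | y.2.1 < lo}
  obtain ⟨h, hinj, hr, hcov⟩ := exists_injective_covering
    (fun (x : ↥I × Fin p) (y : ↥S × Fin hi) => r x.1 y.1) Y₀ hφ hφr
    (ψ := fun y => ψ (y.1.1, ⟨y.1.2.1, y.2⟩))
    (fun y y' hy => by
      have := hψ hy
      simp only [Prod.mk.injEq, Fin.mk.injEq] at this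
      exact Subtype.ext (Prod.ext this.1 (Fin.ext this.2)))
    (fun y => hψr _)
  let f : V → Fin p → V := fun v j => if hv : v ∈ I then (h (⟨v, hv⟩, j)).1.1 else v
  have hload : ∀ s, load I f s = (Finset.univ.filter fun x : ↥I × Fin p => (h x).1.1 = s).card := by
    intro s
    rw [load, ← Finset.sum_attach, Finset.card_filter, Fintype.sum_prod_type]
    refine Finset.sum_congr rfl fun v _ => ?_
    rw [Finset.card_filter]
    refine Finset.sum_congr rfl fun j _ => ?_
    simp [f]
  refine ⟨f, fun v hv j => ?_, fun s hs => ?_⟩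
  · simp only [f, hv, dif_pos]
    exact ⟨(h _).1.2, hr (⟨v, hv⟩, j)⟩
  · rw [hload]
    constructor
    · rw [← Fintype.card_fin lo, ← Finset.card_univ]
      have : ∀ j : Fin lo, ∃ x, h x = (⟨s, hs⟩, ⟨j.1, j.2.trans_le hlh⟩) := fun j => hcov _ j.2
      choose x hx using this
      refine Finset.card_le_card_of_injOn x (fun j _ => by simp [hx]) (fun j _ j' _ hj => ?_)
      have := (hx j).symm.trans ((congrArg h hj).trans (hx j'))
      simpa [Fin.ext_iff] using this
    · refine le_of_le_of_eq (b := (Finset.univ : Finset (Fin hi)).card) ?_ (by simp)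
      refine Finset.card_le_card_of_injOn (fun x => (h x).2) (fun j _ => by simp)
        (fun x hx y hy hxy => hinj ?_)
      simp only [Finset.coe_filter, Finset.mem_univ, true_and, Set.mem_ofPred_eq] at hx hy
      exact Prod.ext (Subtype.ext (hx.trans hy.symm)) hxy

end Assignment

/-! ### Hall conditions from a set of maximal deficiency -/

section Deficiency

variable {V : Type u} [Fintype V] [DecidableEq V] {G : SimpleGraph V} [DecidableRel G.Adj]

/-- `S` maximizes `|isol G D S| - c * |S|` among the subsets of `D`. -/
def IsMaxDeficient (G : SimpleGraph V) [DecidableRel G.Adj] (c : ℕ) (D S : Finset V) : Prop :=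
  S ⊆ D ∧ ∀ T ⊆ D, (isol G D T).card + c * S.card ≤ (isol G D S).card + c * T.card

lemma exists_isMaxDeficient (c : ℕ) (D : Finset V) : ∃ S, IsMaxDeficient G c D S := by
  obtain ⟨S, hS, hmax⟩ := D.powerset.exists_max_image
    (fun T => ((isol G D T).card : ℤ) - c * T.card) ⟨∅, by simp⟩
  refine ⟨S, Finset.mem_powerset.1 hS, fun T hT => ?_⟩
  have := hmax T (Finset.mem_powerset.2 hT)
  zify
  linarith

/-- Compare `S` with `S ∪ T`, which isolates the old isolated vertices as well as those that `T`
isolates in the rest. -/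
lemma IsMaxDeficient.card_isol_sdiff_le {c : ℕ} {D S : Finset V} (h : IsMaxDeficient G c D S)
    {T : Finset V} (hT : T ⊆ D \ (S ∪ isol G D S)) :
    (isol G (D \ (S ∪ isol G D S)) T).card ≤ c * T.card := by
  have hTS : Disjoint S T := by
    rw [Finset.disjoint_left]
    intro x hx hx'
    have := hT hx'
    simp [hx] at this
  have h1 := h.2 (S ∪ T) (Finset.union_subset h.1 (hT.trans Finset.sdiff_subset))
  have h2 : isol G D S ∪ isol G (D \ (S ∪ isol G D S)) T ⊆ isol G D (S ∪ T) := by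
    intro x hx
    rw [Finset.mem_union] at hx
    rcases hx with hx | hx
    · have hxT : x ∉ T := fun h' => by
        have := hT h'
        simp [hx] at this
      rw [mem_isol] at hx ⊢
      exact ⟨hx.1, by simp [hx.2.1, hxT], fun w hw hxw => by simp [hx.2.2 w hw hxw]⟩
    · rw [mem_isol] at hx
      obtain ⟨hxD, hxT, hx⟩ := hx
      simp only [Finset.mem_sdiff, Finset.mem_union, not_or] at hxD
      refine mem_isol.2 ⟨hxD.1, by simp [hxD.2.1, hxT], fun w hw hxw => ?_⟩
      rw [Finset.mem_union]
      by_cases hwS : w ∈ S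
      · exact Or.inl hwS
      refine Or.inr (hx w ?_ hxw)
      simp only [Finset.mem_sdiff, Finset.mem_union, not_or]
      exact ⟨hw, hwS, fun hwI => hxD.2.1 ((mem_isol.1 hwI).2.2 x hxD.1 hxw.symm)⟩
  have h3 := Finset.card_le_card h2
  rw [Finset.card_union_of_disjoint] at h3
  · rw [Finset.card_union_of_disjoint hTS] at h1
    nlinarith
  · rw [Finset.disjoint_left]
    intro x hx hx'
    have := (mem_isol.1 hx').1
    simp [hx] at this

/-- Compare `S` with `S \ T`: vertices of the isolated set without a neighbour in `T` stay isolated.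
-/
lemma IsMaxDeficient.mul_card_le {c : ℕ} {D S : Finset V} (h : IsMaxDeficient G c D S)
    {T : Finset V} (hT : T ⊆ S) :
    c * T.card ≤ {v | v ∈ isol G D S ∧ ∃ s ∈ T, G.Adj v s}.ncard := by
  classical
  have h1 := h.2 (S \ T) (Finset.sdiff_subset.trans h.1)
  have hN : {v | v ∈ isol G D S ∧ ∃ s ∈ T, G.Adj v s} =
      ((isol G D S).filter fun v => ∃ s ∈ T, G.Adj v s : Finset V) := by ext; simp
  rw [hN, Set.ncard_coe_finset]
  have h2 : (isol G D S).filter (fun v => ¬ ∃ s ∈ T, G.Adj v s) ⊆ isol G D (S \ T) := by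
    intro x hx
    rw [Finset.mem_filter, mem_isol] at hx
    refine mem_isol.2 ⟨hx.1.1, fun h => hx.1.2.1 (Finset.mem_sdiff.1 h).1, fun w hw hxw => ?_⟩
    rw [Finset.mem_sdiff]
    exact ⟨hx.1.2.2 w hw hxw, fun hwT => hx.2 ⟨w, hwT, hxw⟩⟩
  have h3 := Finset.card_le_card h2
  have h4 := Finset.card_filter_add_card_filter_not (s := isol G D S) (fun v => ∃ s ∈ T, G.Adj v s)
  have h5 := Finset.card_sdiff_add_card_eq_card hT
  rw [← h5] at h1
  nlinarith

/-- Deleting only the neighbours of `A` in `S` already isolates `A`. -/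
lemma mul_card_le_of_subset_isol {p q : ℕ} {D S : Finset V} (hS : S ⊆ D)
    (h : ∀ T ⊆ D, p * (isol G D T).card ≤ q * T.card) {A : Finset V} (hA : A ⊆ isol G D S) :
    p * A.card ≤ q * {s | s ∈ S ∧ ∃ v ∈ A, G.Adj v s}.ncard := by
  classical
  have hN : {s | s ∈ S ∧ ∃ v ∈ A, G.Adj v s} =
      (S.filter fun s => ∃ v ∈ A, G.Adj v s : Finset V) := by ext; simp
  rw [hN, Set.ncard_coe_finset]
  refine le_trans (Nat.mul_le_mul_left _ (Finset.card_le_card fun v hv => ?_))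
    (h _ ((Finset.filter_subset _ _).trans hS))
  have := mem_isol.1 (hA hv)
  refine mem_isol.2 ⟨this.1, fun h => this.2.1 (Finset.mem_filter.1 h).1, fun w hw hvw => ?_⟩
  exact Finset.mem_filter.2 ⟨this.2.2 w hw hvw, v, hv, hvw⟩

/-- If deleting any `T` isolates at most `|T|` vertices of `D`, then `D` satisfies Hall's condition
with respect to adjacency. -/
lemma card_le_of_card_isol_le {D : Finset V} (h : ∀ T ⊆ D, (isol G D T).card ≤ T.card)
    {A : Finset V} (hA : A ⊆ D) : A.card ≤ {s | s ∈ D ∧ ∃ v ∈ A, G.Adj v s}.ncard := by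
  classical
  have hN : {s | s ∈ D ∧ ∃ v ∈ A, G.Adj v s} =
      (D.filter fun s => ∃ v ∈ A, G.Adj v s : Finset V) := by ext; simp
  rw [hN, Set.ncard_coe_finset]
  -- Vertices with a neighbour in `A` are themselves neighbours of `A`; the others, `A₀`, are
  -- isolated by deleting `N`. These two sets of neighbours are disjoint.
  let A₁ := A.filter fun v => ∃ w ∈ A, G.Adj v w
  let A₀ := A.filter fun v => ¬ ∃ w ∈ A, G.Adj v w
  let N := D.filter fun s => ∃ v ∈ A₀, G.Adj v s
  have h0 : A₀.card ≤ N.card := by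
    refine (Finset.card_le_card fun v hv => ?_).trans (h N (Finset.filter_subset _ _))
    have hv' := Finset.mem_filter.1 hv
    refine mem_isol.2 ⟨hA hv'.1, fun hvN => ?_, fun w hw hvw => Finset.mem_filter.2 ⟨hw, v, hv, hvw⟩⟩
    obtain ⟨u, hu, huv⟩ := (Finset.mem_filter.1 hvN).2
    exact hv'.2 ⟨u, (Finset.mem_filter.1 hu).1, huv.symm⟩
  have hsub : A₁ ∪ N ⊆ D.filter fun s => ∃ v ∈ A, G.Adj v s := by
    intro x hx
    rw [Finset.mem_union] at hx
    rcases hx with hx | hx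
    · obtain ⟨hxA, w, hw, hxw⟩ := Finset.mem_filter.1 hx
      exact Finset.mem_filter.2 ⟨hA hxA, w, hw, hxw.symm⟩
    · obtain ⟨hxD, w, hw, hxw⟩ := Finset.mem_filter.1 hx
      exact Finset.mem_filter.2 ⟨hxD, w, (Finset.mem_filter.1 hw).1, hxw⟩
  have hdisj : Disjoint A₁ N := by
    rw [Finset.disjoint_left]
    intro x hx hxN
    obtain ⟨_, w, hw, hxw⟩ := Finset.mem_filter.1 hxN
    exact (Finset.mem_filter.1 hw).2 ⟨x, (Finset.mem_filter.1 hx).1, hxw⟩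
  have h3 := Finset.card_le_card hsub
  rw [Finset.card_union_of_disjoint hdisj] at h3
  have h4 : A₁.card + A₀.card = A.card :=
    Finset.card_filter_add_card_filter_not (s := A) (fun v => ∃ w ∈ A, G.Adj v w)
  omega

end Deficiency

/-! ### Star factors -/

section StarCover

lemma coverable_of_star_assignment {V : Type u} [DecidableEq V] {G : SimpleGraph V} {k : ℕ}
    {S I : Finset V} (hSI : Disjoint S I) {f : V → Fin 1 → V}
    (hf : ∀ v ∈ I, ∀ j, f v j ∈ S ∧ G.Adj v (f v j))
    (hload : ∀ s ∈ S, 1 ≤ load I f s ∧ load I f s ≤ k) :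
    Coverable k G ((S ∪ I : Finset V) : Set V) := by
  have hcard : ∀ s, load I f s = (I.filter fun v => f v 0 = s).card := fun s => by
    rw [load, Finset.card_filter]
    refine Finset.sum_congr rfl fun v _ => ?_
    by_cases h : f v 0 = s <;> simp [h, Finset.filter_singleton]
  have hu : ((S ∪ I : Finset V) : Set V) =
      ⋃ s : ↥S, insert s.1 ((I.filter fun v => f v 0 = s.1 : Finset V) : Set V) := by
    ext x
    simp only [Finset.coe_union, Set.mem_union, Finset.mem_coe, Set.mem_iUnion, Set.mem_insert_iff,
      Finset.mem_filter]
    constructor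
    · rintro (h | h)
      · exact ⟨⟨x, h⟩, Or.inl rfl⟩
      · exact ⟨⟨f x 0, (hf x h 0).1⟩, Or.inr ⟨h, rfl⟩⟩
    · rintro ⟨s, h | h⟩
      exacts [Or.inl (h ▸ s.2), Or.inr h.1]
  rw [hu]
  refine coverable_iUnion (fun s => isPiece_star ?_ ?_ ?_) ?_
  · rw [← Finset.card_pos, ← hcard]
    exact (hload s s.2).1
  · rw [← hcard]
    exact (hload s s.2).2
  · intro v hv
    rw [Finset.mem_filter] at hv
    exact hv.2 ▸ (hf v hv.1 0).2.symm
  · rintro s t ⟨x, hx, hx'⟩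
    simp only [Set.mem_insert_iff, Finset.mem_coe, Finset.mem_filter] at hx hx'
    have : s = t := by
      apply Subtype.ext
      rcases hx with rfl | hx <;> rcases hx' with hx' | hx'
      · exact hx'
      · exact absurd hx'.1 (Finset.disjoint_left.1 hSI s.2)
      · exact absurd hx.1 (Finset.disjoint_left.1 hSI (hx' ▸ t.2))
      · exact hx.2.symm.trans hx'.2
    rw [this]


variable {V : Type u} [Fintype V] [DecidableEq V] {G : SimpleGraph V} [DecidableRel G.Adj] {k : ℕ}

/-- Each cycle of the permutation has length at least two, because adjacency excludes fixed points.
Listed in order it is a path of `G`; remove it and induct. -/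
lemma coverable_of_perm {V : Type u} [DecidableEq V] {G : SimpleGraph V} {k : ℕ} (hk : 2 ≤ k)
    (n : ℕ) : ∀ (D : Finset V) (σ : V → V), D.card = n →
    (∀ v ∈ D, σ v ∈ D) → Set.InjOn σ D → (∀ v ∈ D, G.Adj v (σ v)) → Coverable k G (D : Set V) := by
  induction n using Nat.strong_induction_on with | _ n ih => ?_
  intro D σ hn hmaps hinj hadj
  rcases D.eq_empty_or_nonempty with rfl | ⟨v, hv⟩
  · simpa using Coverable.empty
  let τ : ↥D → ↥D := fun x => ⟨σ x, hmaps x x.2⟩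
  have hτ : Function.Bijective τ := Finite.injective_iff_bijective.1 fun x y h =>
    Subtype.ext (hinj x.2 y.2 (congrArg Subtype.val h))
  let π : Equiv.Perm ↥D := Equiv.ofBijective τ hτ
  have hπ : ∀ x, G.Adj x.1 (π x).1 := fun x => hadj x x.2
  have hsupp : ∀ x, x ∈ π.support := fun x => by
    rw [Equiv.Perm.mem_support]
    intro h
    exact (hπ x).ne (congrArg Subtype.val h.symm)
  let l : List V := (π.toList ⟨v, hv⟩).map Subtype.val
  have hl : Coverable k G {w | w ∈ l} := by
    apply coverable_of_isChain hk
    · rw [List.isChain_map, List.isChain_iff_getElem]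
      intro i hi
      rw [Equiv.Perm.getElem_toList, Equiv.Perm.getElem_toList, pow_succ', Equiv.Perm.mul_apply]
      exact hπ _
    · exact (Equiv.Perm.nodup_toList _ _).map Subtype.val_injective
    · have := (Equiv.Perm.two_le_length_toList_iff_mem_support (p := π)).2 (hsupp ⟨v, hv⟩)
      rw [List.length_map]
      omega
  have hmem : ∀ w, w ∈ l ↔ ∃ hw : w ∈ D, π.SameCycle ⟨v, hv⟩ ⟨w, hw⟩ := fun w => by
    simp [l, Equiv.Perm.mem_toList_iff, hsupp]
  have hvl : v ∈ l := (hmem v).2 ⟨hv, Equiv.Perm.SameCycle.refl _ _⟩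
  let D' := D.filter (· ∉ l)
  have hD' : Coverable k G (D' : Set V) := by
    refine ih D'.card ?_ D' σ rfl ?_ (hinj.mono fun x hx => (Finset.mem_filter.1 hx).1)
      (fun x hx => hadj x (Finset.mem_filter.1 hx).1)
    · rw [← hn]
      refine Finset.card_lt_card (Finset.filter_ssubset.2 ⟨v, hv, by simpa using hvl⟩)
    · intro x hx
      obtain ⟨hxD, hxl⟩ := Finset.mem_filter.1 hx
      refine Finset.mem_filter.2 ⟨hmaps x hxD, fun h => hxl ?_⟩
      obtain ⟨hw, h⟩ := (hmem _).1 h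
      refine (hmem x).2 ⟨hxD, ?_⟩
      exact (Equiv.Perm.sameCycle_apply_right (f := π) (y := ⟨x, hxD⟩)).1 h
  have := hl.union hD' (by
    rw [Set.disjoint_left]
    intro x hx hx'
    exact (Finset.mem_filter.1 hx').2 hx)
  convert this using 1
  ext x
  simp only [Finset.mem_coe, Set.mem_union, Set.mem_ofPred_eq, D', Finset.mem_filter]
  constructor
  · intro h
    by_cases hx : x ∈ l
    exacts [Or.inl hx, Or.inr ⟨h, hx⟩]
  · rintro (h | h)
    exacts [((hmem x).1 h).1, h.1]

lemma coverable_of_card_isol_le_card (hk : 2 ≤ k) {D : Finset V}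
    (h : ∀ T ⊆ D, (isol G D T).card ≤ T.card) : Coverable k G (D : Set V) := by
  -- With both sides equal to `D`, upper load `1` means that the assignment is injective, hence a
  -- permutation of `D`.
  obtain ⟨f, hf, hload⟩ := exists_assignment (p := 1) (lo := 0) (hi := 1) G.Adj D D (by omega)
    (fun A hA => by simpa using card_le_of_card_isol_le h hA) (by simp)
  refine coverable_of_perm hk _ D (fun v => f v 0) rfl (fun v hv => (hf v hv 0).1)
    (fun v hv w hw hvw => ?_) (fun v hv => (hf v hv 0).2)
  by_contra hne
  have h1 := (hload _ (hf v hv 0).1).2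
  have h2 : ∑ x ∈ {v, w}, (Finset.univ.filter fun j => f x j = f v 0).card ≤ load D f (f v 0) :=
    Finset.sum_le_sum_of_subset (by
      intro x hx
      simp only [Finset.mem_insert, Finset.mem_singleton] at hx
      rcases hx with rfl | rfl
      exacts [hv, hw])
  rw [Finset.sum_pair hne] at h2
  simp only at hvw
  simp [Finset.filter_singleton, ← hvw] at h2
  omega

lemma disjoint_isol (D S : Finset V) : Disjoint S (isol G D S) :=
  Finset.disjoint_left.2 fun _ hx hx' => (mem_isol.1 hx').2.1 hx

lemma union_isol_subset {D S : Finset V} (hS : S ⊆ D) : S ∪ isol G D S ⊆ D :=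
  Finset.union_subset hS fun _ hx => (mem_isol.1 hx).1

/-- The star-factor theorem of Las Vergnas and of Amahashi and Kano. -/
lemma coverable_of_card_isol_le (hk : 2 ≤ k) {D : Finset V}
    (h : ∀ T ⊆ D, (isol G D T).card ≤ k * T.card) : Coverable k G (D : Set V) := by
  -- With deficiency constant `1`, each `s ∈ S` gets between `1` and `k` isolated vertices as
  -- leaves, and the rest has a permutation along edges.
  obtain ⟨S, hS⟩ := exists_isMaxDeficient (G := G) 1 D
  obtain ⟨f, hf, hload⟩ := exists_assignment (p := 1) (lo := 1) (hi := k) G.Adj (isol G D S) S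
    (by omega) (fun A hA => mul_card_le_of_subset_isol hS.1 (by simpa using h) hA)
    (fun T hT => by simpa using hS.mul_card_le hT)
  have h1 := coverable_of_star_assignment (disjoint_isol D S) hf hload
  have h2 := coverable_of_card_isol_le_card (G := G) hk (D := D \ (S ∪ isol G D S))
    (fun T hT => by simpa using hS.card_isol_sdiff_le hT)
  have := h1.union h2 (by exact_mod_cast Finset.disjoint_sdiff)
  rwa [← Finset.coe_union, Finset.union_sdiff_of_subset (union_isol_subset hS.1)] at this

end StarCover

/-! ### Recognizing members of `𝒯(2k+1)` -/

section TreeCriterion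

lemma forall_of_preconnected {X : Type*} {H : SimpleGraph X} (hc : H.Preconnected) {P : X → Prop}
    (hP : ∀ u v, H.Adj u v → P u → P v) {u : X} (hu : P u) (v : X) : P v := by
  obtain ⟨p⟩ := hc u v
  induction p with
  | nil => exact hu
  | cons h _ ih => exact ih (hP _ _ h hu)

variable {X : Type u} [Fintype X] [DecidableEq X] {H : SimpleGraph X} {S : Finset X}

lemma mem_of_adj_of_notMem (hbip : H.IsBipartiteWith S ↑(Sᶜ)) {u v : X} (h : H.Adj u v)
    (hu : u ∉ S) : v ∈ S := by
  rcases hbip.mem_of_adj h with h | h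
  · exact absurd h.1 hu
  · exact h.2

lemma notMem_of_adj_of_mem (hbip : H.IsBipartiteWith S ↑(Sᶜ)) {u v : X} (h : H.Adj u v)
    (hu : u ∈ S) : v ∉ S := by
  rcases hbip.mem_of_adj h with h | h
  · simpa using h.2
  · simp [hu] at h

variable [DecidableRel H.Adj]

/-- The vertices outside `S` of degree two. -/
abbrev deg2 (H : SimpleGraph X) [DecidableRel H.Adj] (S : Finset X) : Finset X :=
  Sᶜ.filter fun i => H.degree i = 2

/-- Counted from outside `S`, the edges number `|Sᶜ| + |deg2 H S|`; in a tree they number `|S| +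
|Sᶜ| - 1`. -/
lemma card_eq_card_deg2_add_one (hT : H.IsTree) (hbip : H.IsBipartiteWith S ↑(Sᶜ))
    (hdeg : ∀ i ∉ S, H.degree i = 1 ∨ H.degree i = 2) :
    S.card = (deg2 H S).card + 1 := by
  have h1 := SimpleGraph.isBipartiteWith_sum_degrees_eq_card_edges' hbip
  have h2 := hT.card_edgeFinset
  have h3 : ∑ i ∈ Sᶜ, H.degree i = ∑ i ∈ Sᶜ, (1 + if H.degree i = 2 then 1 else 0) :=
    Finset.sum_congr rfl fun i hi => by
      rcases hdeg i (Finset.mem_compl.1 hi) with h | h <;> simp [h]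
  rw [Finset.sum_add_distrib, ← Finset.card_filter, Finset.sum_const, smul_eq_mul, mul_one] at h3
  have h4 := Finset.card_add_card_compl S
  change _ = _ + (deg2 H S).card at h3
  omega

/-- Otherwise connectedness and parity give every `s` at least two neighbours of degree two. Double
counting then yields `|S| ≤ |deg2 H S|`, one too few for a tree. -/
lemma deg2_eq_empty_of_even (hT : H.IsTree) (hbip : H.IsBipartiteWith S ↑(Sᶜ))
    (hdeg : ∀ i ∉ S, H.degree i = 1 ∨ H.degree i = 2)
    (heven : ∀ s ∈ S, Even ((deg2 H S).filter fun i => H.Adj s i).card) : deg2 H S = ∅ := by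
  by_contra hne
  obtain ⟨b, hb⟩ := Finset.nonempty_iff_ne_empty.2 hne
  have hpos : ∀ s ∈ S, 2 ≤ ((deg2 H S).filter fun i => H.Adj s i).card := by
    intro s hs
    have h0 : ((deg2 H S).filter fun i => H.Adj s i).card ≠ 0 := by
      intro h0
      rw [Finset.card_eq_zero, Finset.filter_eq_empty_iff] at h0
      -- Without neighbours of degree two, `s` and its leaves would be the whole tree, leaving no
      -- room for `b`.
      have key := forall_of_preconnected hT.connected.preconnected
        (P := fun x => x = s ∨ (H.Adj s x ∧ H.degree x = 1)) (fun u v huv hu => by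
          rcases hu with rfl | ⟨hu, hu1⟩
          · have hv := notMem_of_adj_of_mem hbip huv hs
            rcases hdeg v hv with h | h
            · exact Or.inr ⟨huv, h⟩
            · exact absurd huv (h0 (by simp [hv, h]))
          · obtain ⟨w, hw, hw'⟩ := SimpleGraph.degree_eq_one_iff_existsUnique_adj.1 hu1
            exact Or.inl ((hw' v huv).trans (hw' s hu.symm).symm)) (Or.inl rfl) b
      simp only [Finset.mem_filter, Finset.mem_compl] at hb
      rcases key with rfl | h
      · exact hb.1 hs
      · omega
    obtain ⟨r, hr⟩ := heven s hs
    omega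
  have h1 : ∑ s ∈ S, ((deg2 H S).filter fun i => H.Adj s i).card = (deg2 H S).card * 2 := by
    have := Finset.sum_card_bipartiteAbove_eq_sum_card_bipartiteBelow (s := S) (t := deg2 H S) H.Adj
    simp only [Finset.bipartiteAbove, Finset.bipartiteBelow] at this
    rw [this]
    refine Finset.sum_const_nat fun i hi => ?_
    simp only [Finset.mem_filter, Finset.mem_compl] at hi
    rw [← hi.2, ← H.card_neighborFinset_eq_degree]
    congr 1
    ext s
    simp only [Finset.mem_filter, SimpleGraph.mem_neighborFinset]
    exact ⟨fun h => h.2.symm, fun h => ⟨mem_of_adj_of_notMem hbip h hi.1, h.symm⟩⟩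
  have h2 : S.card * 2 ≤ ∑ s ∈ S, ((deg2 H S).filter fun i => H.Adj s i).card := by
    simpa using Finset.card_nsmul_le_sum S _ 2 hpos
  have h3 := card_eq_card_deg2_add_one hT hbip hdeg
  omega

/-! ### The base tree obtained by undoing the subdivision -/

section Contract

variable {W : Type} (ι : W → X)

/-- The graph on `W` obtained from `H` by contracting the paths through vertices of degree two
outside `S`. -/
def contract (H : SimpleGraph X) [DecidableRel H.Adj] (S : Finset X) : SimpleGraph W where
  Adj a b := a ≠ b ∧ (H.Adj (ι a) (ι b) ∨ ∃ c ∈ deg2 H S, H.Adj c (ι a) ∧ H.Adj c (ι b))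
  symm := ⟨fun _ _ h => ⟨h.1.symm, h.2.imp (fun h => h.symm) fun ⟨c, hc, h1, h2⟩ => ⟨c, hc, h2, h1⟩⟩⟩
  loopless := ⟨fun _ h => h.1 rfl⟩

variable {ι}

lemma contract_connected [Nonempty W] (hι : Function.Injective ι)
    (hrange : ∀ x, (∃ w, ι w = x) ↔ x ∉ deg2 H S)
    (hc : H.Connected) (hbip : H.IsBipartiteWith S ↑(Sᶜ)) : (contract ι H S).Connected := by
  -- A suppressed vertex is represented by either of its neighbours, so that the induction can run
  -- through it.
  have hstep : ∀ x y : X, H.Walk x y → ∀ a b : W,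
      (ι a = x ∨ (x ∈ deg2 H S ∧ H.Adj x (ι a))) → (ι b = y ∨ (y ∈ deg2 H S ∧ H.Adj y (ι b))) →
      (contract ι H S).Reachable a b := by
    intro x y p
    have htwo : ∀ x ∈ deg2 H S, ∀ a b : W, H.Adj x (ι a) → H.Adj x (ι b) →
        (contract ι H S).Reachable a b := by
      intro x hx a b ha hb
      by_cases hab : a = b
      · rw [hab]
      · exact SimpleGraph.Adj.reachable ⟨hab, Or.inr ⟨x, hx, ha, hb⟩⟩
    induction p with
    | @nil x =>
      rintro a b (ha | ⟨hx, ha⟩) (hb | ⟨hx', hb⟩)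
      · rw [hι (ha.trans hb.symm)]
      · exact absurd hx' ((hrange x).1 ⟨a, ha⟩)
      · exact absurd hx ((hrange x).1 ⟨b, hb⟩)
      · exact htwo x hx a b ha hb
    | @cons x z y hxz p ih =>
      rintro a b (rfl | ⟨hx, ha⟩) hb
      · by_cases hz : z ∈ deg2 H S
        · exact ih a b (Or.inr ⟨hz, hxz.symm⟩) hb
        · obtain ⟨c, rfl⟩ := (hrange z).2 hz
          refine SimpleGraph.Reachable.trans (SimpleGraph.Adj.reachable ?_) (ih c b (Or.inl rfl) hb)
          exact ⟨fun h => hxz.ne (congrArg ι h), Or.inl hxz⟩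
      · have hzS : z ∈ S := mem_of_adj_of_notMem hbip hxz (by simp at hx; exact hx.1)
        obtain ⟨c, rfl⟩ := (hrange z).2 (by simp [hzS])
        exact (htwo x hx a c ha hxz).trans (ih c b (Or.inl rfl) hb)
  refine ⟨fun a b => ?_⟩
  obtain ⟨p⟩ := hc.preconnected (ι a) (ι b)
  exact hstep _ _ p a b (Or.inl rfl) (Or.inl rfl)

/-- Every edge of the contraction comes from a vertex outside `S`. -/
lemma exists_mid (hι : Function.Injective ι) (hrange : ∀ x, (∃ w, ι w = x) ↔ x ∉ deg2 H S)
    (hbip : H.IsBipartiteWith S ↑(Sᶜ)) (hdeg : ∀ i ∉ S, H.degree i = 1 ∨ H.degree i = 2)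
    (e : (contract ι H S).edgeSet) :
    ∃ i : ↥(Sᶜ), ∀ w, w ∈ e.1 ↔ (ι w = i ∨ H.Adj i (ι w)) := by
  have hdirect : ∀ a b, ι a ∉ S → H.Adj (ι a) (ι b) →
      ∃ i : ↥(Sᶜ), ∀ w, (w = a ∨ w = b) ↔ (ι w = i ∨ H.Adj i (ι w)) := by
    intro a b ha hab
    have h1 : H.degree (ι a) = 1 := (hdeg _ ha).resolve_right fun h =>
      (hrange (ι a)).1 ⟨a, rfl⟩ (by simp [ha, h])
    obtain ⟨x, hx, hx'⟩ := SimpleGraph.degree_eq_one_iff_existsUnique_adj.1 h1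
    refine ⟨⟨ι a, by simpa using ha⟩, fun w => or_congr hι.eq_iff.symm ⟨?_, fun h => ?_⟩⟩
    · rintro rfl
      exact hab
    · exact hι ((hx' _ h).trans (hx' _ hab).symm)
  obtain ⟨e, he⟩ := e
  induction e using Sym2.ind with | _ a b => ?_
  simp only [Sym2.mem_iff]
  obtain ⟨hne, h | ⟨c, hc, ha, hb⟩⟩ := (SimpleGraph.mem_edgeSet _).1 he
  · by_cases haS : ι a ∈ S
    · obtain ⟨i, hi⟩ := hdirect b a (notMem_of_adj_of_mem hbip h haS) h.symm
      exact ⟨i, fun w => or_comm.trans (hi w)⟩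
    · exact hdirect a b haS h
  · have hc' := Finset.mem_filter.1 hc
    have hN : H.neighborFinset c = {ι a, ι b} := by
      symm
      apply Finset.eq_of_subset_of_card_le
      · intro x hx
        simp only [Finset.mem_insert, Finset.mem_singleton] at hx
        rcases hx with rfl | rfl <;> simpa
      · rw [H.card_neighborFinset_eq_degree, hc'.2, Finset.card_pair (hι.ne hne)]
    refine ⟨⟨c, hc'.1⟩, fun w => ?_⟩
    have hw : ι w ≠ c := fun h => (hrange c).1 ⟨w, h⟩ hc
    have h1 : H.Adj c (ι w) ↔ ι w ∈ H.neighborFinset c := by simp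
    simp [hw, h1, hN, hι.eq_iff]

-- Edges of the contraction correspond to vertices outside `S`: a leaf to its pendant edge, a vertex
-- of degree two to the edge replacing it. Saturation of `S` makes the core degrees odd and leaves
-- no pendant edges to add.
set_option maxHeartbeats 1000000 in
lemma contract_isBaseTree_and_iso [Fintype W] (hι : Function.Injective ι)
    (hrange : ∀ x, (∃ w, ι w = x) ↔ x ∉ deg2 H S) {k : ℕ} (hk : 2 ≤ k) (hT : H.IsTree)
    (hbip : H.IsBipartiteWith S ↑(Sᶜ)) (hdeg : ∀ i ∉ S, H.degree i = 1 ∨ H.degree i = 2)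
    (hload : ∀ s ∈ S, 2 * (Finset.univ.filter fun i => H.Adj s i ∧ H.degree i = 1).card +
      (Finset.univ.filter fun i => H.Adj s i ∧ H.degree i = 2).card = 2 * k + 1) :
    IsBaseTree (contract ι H S) k ∧ Nonempty (H ≃g treeOf (contract ι H S) k) := by
  classical
  set B := deg2 H S with hB
  obtain ⟨R, hR⟩ : ∃ R, R = contract ι H S := ⟨_, rfl⟩
  have hcardS := card_eq_card_deg2_add_one hT hbip hdeg
  have hBS : B ⊆ Sᶜ := Finset.filter_subset _ _
  have hcard : Nat.card W = (Sᶜ).card + 1 := by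
    have h1 := Finset.card_add_card_compl B
    have h2 := Finset.card_add_card_compl S
    have h3 : Nat.card W = (Bᶜ).card := by
      rw [Nat.card_eq_fintype_card, ← Finset.card_univ, ← Finset.card_map ⟨ι, hι⟩]
      congr 1
      ext x
      simpa using hrange x
    rw [← hB] at hcardS
    omega
  have : Nonempty W := (Nat.card_pos_iff.1 (by omega)).1
  rw [← hR]
  have hRc : R.Connected := hR ▸ contract_connected hι hrange hT.connected hbip
  obtain ⟨m, hm⟩ : ∃ m : R.edgeSet → ↥(Sᶜ), ∀ e w, w ∈ e.1 ↔ (ι w = m e ∨ H.Adj (m e) (ι w)) := by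
    subst hR
    choose m hm using exists_mid hι hrange hbip hdeg
    exact ⟨m, hm⟩
  have hminj : Function.Injective m := fun e e' h => Subtype.ext (Sym2.ext fun w => by
    rw [hm e, hm e', h])
  have hle : Nat.card R.edgeSet ≤ (Sᶜ).card := by
    have := Nat.card_le_card_of_injective m hminj
    rwa [Nat.card_eq_fintype_card (α := ↥(Sᶜ)), Fintype.card_coe] at this
  have hge := hRc.card_vert_le_card_edgeSet_add_one
  -- Injectivity of `m` bounds the edges above by `|Sᶜ| = |W| - 1` and connectedness bounds them
  -- below. Equality makes `R` a tree and `m` a bijection.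
  have hRT : R.IsTree := SimpleGraph.isTree_iff_connected_and_card.2 ⟨hRc, by omega⟩
  have hmbij : Function.Bijective m := by
    refine (Nat.bijective_iff_injective_and_card m).2 ⟨hminj, ?_⟩
    rw [Nat.card_eq_fintype_card (α := ↥(Sᶜ)), Fintype.card_coe]
    omega
  have hιB : ∀ w, ι w ∉ B := fun w => (hrange _).1 ⟨w, rfl⟩
  have hRleaf : ∀ a b, ι b ∉ S → (R.Adj a b ↔ H.Adj (ι a) (ι b)) := by
    intro a b hb
    rw [hR]
    constructor
    · rintro ⟨_, h | ⟨c, hc, _, hcb⟩⟩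
      · exact h
      · exact absurd (mem_of_adj_of_notMem hbip hcb (Finset.mem_compl.1 (hBS hc))) hb
    · exact fun h => ⟨fun hab => h.ne (congrArg ι hab), Or.inl h⟩
  have hdeg1 : ∀ w, ι w ∉ S → H.degree (ι w) = 1 := fun w hw =>
    (hdeg _ hw).resolve_right fun h => hιB w (by simp [hB, hw, h])
  have hmB : ∀ e : R.edgeSet, (∀ w ∈ e.1, ι w ∈ S) → (m e).1 ∈ B := by
    intro e he
    by_contra h
    obtain ⟨w, hw⟩ := (hrange _).2 h
    have := he w ((hm e w).2 (Or.inl hw))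
    rw [hw] at this
    exact Finset.mem_compl.1 (m e).2 this
  have hleafN : ∀ w, {b | R.Adj w b ∧ ι b ∉ S}.ncard = if ι w ∈ S then
      (Finset.univ.filter fun i => H.Adj (ι w) i ∧ H.degree i = 1).card else 0 := by
    intro w
    split_ifs with hw
    · rw [← Set.ncard_coe_finset, ← Set.ncard_image_of_injective _ hι]
      congr 1
      ext x
      simp only [Set.mem_image, Set.mem_ofPred_eq, Finset.coe_filter, Finset.mem_univ, true_and]
      constructor
      · rintro ⟨b, ⟨hb, hbS⟩, rfl⟩
        exact ⟨(hRleaf w b hbS).1 hb, hdeg1 b hbS⟩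
      · rintro ⟨hx, hx1⟩
        have hxS := notMem_of_adj_of_mem hbip hx hw
        obtain ⟨b, rfl⟩ := (hrange x).2 (by simp [hB, hx1])
        exact ⟨b, ⟨(hRleaf w b hxS).2 hx, hxS⟩, rfl⟩
    · rw [Set.ncard_eq_zero]
      ext b
      simp only [Set.mem_ofPred_eq, Set.mem_empty_iff_false, iff_false, not_and, not_not]
      intro h
      by_contra hb
      exact hb (mem_of_adj_of_notMem hbip ((hRleaf w b hb).1 h) hw)
  have hcoreN : ∀ w, ι w ∈ S → {b | R.Adj w b ∧ ι b ∈ S}.ncard =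
      (Finset.univ.filter fun i => H.Adj (ι w) i ∧ H.degree i = 2).card := by
    intro w hw
    rw [← Set.ncard_coe_finset]
    have hcl : ∀ b, R.Adj w b ∧ ι b ∈ S → ∀ x ∈ s(w, b), ι x ∈ S := by
      rintro b ⟨_, hb⟩ x hx
      rcases Sym2.mem_iff.1 hx with rfl | rfl <;> assumption
    -- A core neighbour `b` of `w` is matched with the suppressed vertex between them.
    refine Set.ncard_congr (fun b hb => (m ⟨s(w, b), hb.1⟩).1) ?_ ?_ ?_
    · intro b hb
      have h1 := hmB ⟨s(w, b), hb.1⟩ (hcl b hb)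
      have h2 := (hm ⟨s(w, b), hb.1⟩ w).1 (Sym2.mem_mk_left _ _)
      simp only [Finset.coe_filter, Finset.mem_univ, true_and, Set.mem_ofPred_eq]
      refine ⟨?_, (Finset.mem_filter.1 h1).2⟩
      rcases h2 with h2 | h2
      · exact absurd h1 (h2 ▸ hιB w)
      · exact h2.symm
    · intro b b' hb hb' h
      exact Sym2.congr_right.1 (congrArg Subtype.val (hminj (Subtype.ext h)))
    · intro i hi
      simp only [Finset.coe_filter, Finset.mem_univ, true_and, Set.mem_ofPred_eq] at hi
      have hiS := notMem_of_adj_of_mem hbip hi.1 hw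
      obtain ⟨e, he⟩ := hmbij.2 ⟨i, Finset.mem_compl.2 hiS⟩
      have hwe : w ∈ e.1 := (hm e w).2 (Or.inr (by rw [he]; exact hi.1.symm))
      obtain ⟨b, hb⟩ := hwe
      have hadj : R.Adj w b := by
        have := e.2
        rwa [hb] at this
      have hee : e = ⟨s(w, b), hadj⟩ := Subtype.ext hb
      have hbS : ι b ∈ S := by
        have := (hm e b).1 (by rw [hb]; exact Sym2.mem_mk_right _ _)
        rw [he] at this
        rcases this with h | h
        · exact absurd (by simp [hB, h, hiS, hi.2] : ι b ∈ B) (hιB b)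
        · exact mem_of_adj_of_notMem hbip h hiS
      exact ⟨b, ⟨hadj, hbS⟩, by rw [← hee, he]⟩
  have hleaves : ∀ w, w ∈ leaves R ↔ ι w ∉ S := by
    intro w
    have hsplit : R.neighborSet w = {b | R.Adj w b ∧ ι b ∉ S} ∪ {b | R.Adj w b ∧ ι b ∈ S} := by
      ext b
      simp only [SimpleGraph.mem_neighborSet, Set.mem_union, Set.mem_ofPred_eq]
      tauto
    have hnc : (R.neighborSet w).ncard =
        {b | R.Adj w b ∧ ι b ∉ S}.ncard + {b | R.Adj w b ∧ ι b ∈ S}.ncard := by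
      rw [hsplit]
      exact Set.ncard_union_eq (Set.disjoint_left.2 fun b h h' => h.2 h'.2)
    rw [leaves, Set.mem_ofPred_eq, hnc, hleafN]
    by_cases hw : ι w ∈ S
    · rw [if_pos hw, hcoreN w hw]
      -- A vertex of `S` is not a leaf of `R`: a single neighbour would contribute at most `2 <
      -- 2k+1`.
      have := hload _ hw
      simp only [hw, not_true_eq_false, iff_false]
      omega
    · rw [if_neg hw]
      simp only [hw, not_false_eq_true, iff_true, zero_add]
      obtain ⟨x, hx, hx'⟩ := SimpleGraph.degree_eq_one_iff_existsUnique_adj.1 (hdeg1 w hw)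
      have hxS := mem_of_adj_of_notMem hbip hx hw
      obtain ⟨c, rfl⟩ := (hrange x).2 (fun h => Finset.mem_compl.1 (hBS h) hxS)
      rw [Set.ncard_eq_one]
      refine ⟨c, ?_⟩
      ext b
      simp only [Set.mem_ofPred_eq, Set.mem_singleton_iff]
      constructor
      · rintro ⟨h, _⟩
        exact hι (hx' _ ((hRleaf b w hw).1 h.symm).symm)
      · rintro rfl
        exact ⟨((hRleaf b w hw).2 hx.symm).symm, hxS⟩
  have hcoreS : ∀ x : ↥(leaves R)ᶜ, ι x ∈ S := fun x => by
    by_contra h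
    exact x.2 ((hleaves x).2 h)
  have hcd : ∀ x : ↥(leaves R)ᶜ, coreDegree R x =
      (Finset.univ.filter fun i => H.Adj (ι x) i ∧ H.degree i = 2).card := by
    intro x
    rw [← hcoreN x (hcoreS x), coreDegree, ← Set.ncard_image_of_injective _ Subtype.val_injective]
    congr 1
    ext b
    simp only [Set.mem_image, SimpleGraph.mem_neighborSet, Set.mem_ofPred_eq]
    constructor
    · rintro ⟨y, hy, rfl⟩
      exact ⟨hy, hcoreS y⟩
    · rintro ⟨h1, h2⟩
      exact ⟨⟨b, fun h => (hleaves b).1 h h2⟩, h1, rfl⟩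
  have hlc : ∀ x : ↥(leaves R)ᶜ, leafCount R x =
      (Finset.univ.filter fun i => H.Adj (ι x) i ∧ H.degree i = 1).card := by
    intro x
    have := hleafN x
    rw [if_pos (hcoreS x)] at this
    rw [← this, leafCount]
    congr 1
    ext b
    simp [hleaves]
  have hsum : ∀ x : ↥(leaves R)ᶜ, 2 * leafCount R x + coreDegree R x = 2 * k + 1 := fun x => by
    rw [hlc, hcd]
    exact hload _ (hcoreS x)
  -- If the core degree is `2r+1`, saturation says that the leaf count is already `k - r`.
  have hadd : ∀ x : ↥(leaves R)ᶜ, addedCount R k x = 0 := fun x => by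
    have := hsum x
    rw [addedCount]
    split_ifs <;> omega
  refine ⟨⟨hRT, fun x => ⟨⟨?_, ?_⟩, (hsum x).le⟩⟩, ⟨RelIso.symm ?_⟩⟩
  · have := hsum x
    rw [Nat.odd_iff]
    omega
  · have := hsum x
    omega
  let E : (core R).edgeSet → R.edgeSet := fun e =>
    (SimpleGraph.Embedding.induce (G := R) (leaves R)ᶜ).mapEdgeSet e
  have hEinj : Function.Injective E := (SimpleGraph.Embedding.mapEdgeSet _).injective
  have hE : ∀ e w, w ∈ (E e).1 ↔ ∃ h : w ∈ (leaves R)ᶜ, (⟨w, h⟩ : ↥(leaves R)ᶜ) ∈ e.1 := by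
    rintro ⟨e, he⟩ w
    induction e using Sym2.ind with | _ a b => ?_
    have : (E ⟨s(a, b), he⟩).1 = s(a.1, b.1) := rfl
    rw [this]
    simp only [Sym2.mem_iff, Subtype.ext_iff]
    constructor
    · rintro (rfl | rfl)
      exacts [⟨a.2, Or.inl rfl⟩, ⟨b.2, Or.inr rfl⟩]
    · rintro ⟨_, h⟩
      exact h
  have hEB : ∀ e, (m (E e)).1 ∈ B := fun e => hmB _ fun w hw => by
    obtain ⟨h, _⟩ := (hE e w).1 hw
    exact hcoreS ⟨w, h⟩
  let φ : TVertex R k → X := fun t => match t with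
    | .old w => ι w
    | .mid e => (m (E e)).1
    | .pendant x _ => ι x
  have hno : ∀ (x : ↥(leaves R)ᶜ) (i : Fin (addedCount R k x)), False := fun x i =>
    (Fin.cast (hadd x) i).elim0
  have hφinj : Function.Injective φ := by
    rintro (w | e | ⟨x, i⟩) (w' | e' | ⟨x', i'⟩) h
    · exact congrArg _ (hι h)
    · exact absurd ((show ι w = (m (E e')).1 from h) ▸ hEB e') (hιB w)
    · exact (hno _ i').elim
    · exact absurd ((show (m (E e)).1 = ι w' from h) ▸ hEB e) (hιB w')
    · exact congrArg _ (hEinj (hminj (Subtype.ext h)))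
    · exact (hno _ i').elim
    · exact (hno _ i).elim
    · exact (hno _ i).elim
    · exact (hno _ i).elim
  have hφsurj : Function.Surjective φ := by
    intro x
    by_cases hx : x ∈ B
    · obtain ⟨e, he⟩ := hmbij.2 ⟨x, hBS hx⟩
      have hxS := Finset.mem_compl.1 (hBS hx)
      have heS : ∀ w ∈ e.1, w ∈ (leaves R)ᶜ := by
        intro w hw hl
        have := (hm e w).1 hw
        rw [he] at this
        rcases this with h | h
        · exact hιB w (h ▸ hx)
        · exact (hleaves w).1 hl (mem_of_adj_of_notMem hbip h hxS)
      obtain ⟨e, hadj⟩ := e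
      induction e using Sym2.ind with | _ a b => ?_
      refine ⟨.mid ⟨s(⟨a, heS a (Sym2.mem_mk_left _ _)⟩, ⟨b, heS b (Sym2.mem_mk_right _ _)⟩),
        hadj⟩, ?_⟩
      exact congrArg Subtype.val he
    · obtain ⟨w, rfl⟩ := (hrange x).2 hx
      exact ⟨.old w, rfl⟩
  have hold : ∀ a b, TRel R k (.old a) (.old b) ↔ R.Adj a b ∧ b ∈ leaves R := fun a b =>
    ⟨fun h => by cases h; exact ⟨by assumption, by assumption⟩, fun h => .leafEdge a b h.1 h.2⟩
  have hmid : ∀ a e, TRel R k (.old a) (.mid e) ↔ a ∈ (E e).1 := by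
    intro a e
    rw [hE]
    constructor
    · intro h
      cases h with | half x _ hx => exact ⟨x.2, hx⟩
    · rintro ⟨h, he⟩
      exact .half ⟨a, h⟩ e he
  have hmid' : ∀ e t, ¬ TRel R k (.mid e) t := fun e t h => by cases h
  have hHmid : ∀ a e, H.Adj (ι a) (m (E e)).1 ↔ a ∈ (E e).1 := by
    intro a e
    rw [hm]
    have : ι a ≠ (m (E e)).1 := fun h => hιB a (h ▸ hEB e)
    simp [this, SimpleGraph.adj_comm]
  refine ⟨Equiv.ofBijective φ ⟨hφinj, hφsurj⟩, ?_⟩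
  rintro (a | e | ⟨x, i⟩) (b | e' | ⟨x', i'⟩)
  · change H.Adj (ι a) (ι b) ↔ _
    simp only [treeOf, SimpleGraph.fromRel_adj, hold, hleaves]
    constructor
    · intro h
      refine ⟨fun hab => h.ne (congrArg φ hab), ?_⟩
      by_cases ha : ι a ∈ S
      · have hb := notMem_of_adj_of_mem hbip h ha
        exact Or.inl ⟨(hRleaf a b hb).2 h, hb⟩
      · exact Or.inr ⟨(hRleaf b a ha).2 h.symm, ha⟩
    · rintro ⟨_, ⟨h, hb⟩ | ⟨h, ha⟩⟩
      · exact (hRleaf a b hb).1 h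
      · exact ((hRleaf b a ha).1 h).symm
  · change H.Adj (ι a) (m (E e')).1 ↔ _
    simp only [treeOf, SimpleGraph.fromRel_adj, hmid, hmid', hHmid, or_false, ne_eq,
      reduceCtorEq, not_false_eq_true, true_and]
  · exact (hno _ i').elim
  · change H.Adj (m (E e)).1 (ι b) ↔ _
    rw [SimpleGraph.adj_comm]
    simp only [treeOf, SimpleGraph.fromRel_adj, hmid, hmid', hHmid, false_or, ne_eq,
      reduceCtorEq, not_false_eq_true, true_and]
  · change H.Adj (m (E e)).1 (m (E e')).1 ↔ _
    simp only [treeOf, SimpleGraph.fromRel_adj, hmid', or_self, and_false, iff_false]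
    intro h
    exact Finset.mem_compl.1 (m (E e')).2 (mem_of_adj_of_notMem hbip h
      (Finset.mem_compl.1 (m (E e)).2))
  · exact (hno _ i').elim
  · exact (hno _ i).elim
  · exact (hno _ i).elim
  · exact (hno _ i).elim

end Contract

/-- A tree with a bipartition in which the vertices outside `S` have degree one or two is a member
of `𝒯(2k+1)` as soon as the vertices of `S` are saturated. -/
lemma isInT_of_isTree {k : ℕ} (hk : 2 ≤ k) (hT : H.IsTree) (hbip : H.IsBipartiteWith S ↑(Sᶜ))
    (hdeg : ∀ i ∉ S, H.degree i = 1 ∨ H.degree i = 2)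
    (hload : ∀ s ∈ S, 2 * (Finset.univ.filter fun i => H.Adj s i ∧ H.degree i = 1).card +
      (Finset.univ.filter fun i => H.Adj s i ∧ H.degree i = 2).card = 2 * k + 1) :
    IsInT k H := by
  let em : Fin ((deg2 H S)ᶜ).card ≃ ↥((deg2 H S)ᶜ) := ((deg2 H S)ᶜ).equivFin.symm
  let ι : Fin ((deg2 H S)ᶜ).card → X := fun w => (em w).1
  have hι : Function.Injective ι := Subtype.val_injective.comp em.injective
  have hrange : ∀ x, (∃ w, ι w = x) ↔ x ∉ deg2 H S := fun x => by
    constructor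
    · rintro ⟨w, rfl⟩
      exact Finset.mem_compl.1 (em w).2
    · intro hx
      exact ⟨em.symm ⟨x, Finset.mem_compl.2 hx⟩, by simp [ι]⟩
  exact ⟨_, _, contract_isBaseTree_and_iso hι hrange hk hT hbip hdeg hload⟩

end TreeCriterion

/-! ### Half-edge assignments with fewest split vertices -/

section HalfAssignment

variable {V : Type u} [DecidableEq V]

/-- An assignment of two half-edges to every vertex of `I`, with ends in `S` and with loads between
`2k` and `2k+1`. -/
structure IsHalfAssignment (k : ℕ) (G : SimpleGraph V) (S I : Finset V) (f : V → Fin 2 → V) :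
    Prop where
  disj : Disjoint S I
  mem : ∀ v ∈ I, ∀ j, f v j ∈ S
  adj : ∀ v ∈ I, ∀ j, G.Adj v (f v j)
  le_load : ∀ s ∈ S, 2 * k ≤ load I f s
  load_le : ∀ s ∈ S, load I f s ≤ 2 * k + 1

/-- The vertices whose two half-edges have different ends. -/
def splitSet (I : Finset V) (f : V → Fin 2 → V) : Finset V := I.filter fun v => f v 0 ≠ f v 1

/-- `f` has the least number of split vertices. -/
def IsMinHalfAssignment (k : ℕ) (G : SimpleGraph V) (S I : Finset V) (f : V → Fin 2 → V) : Prop :=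
  IsHalfAssignment k G S I f ∧
    ∀ g, IsHalfAssignment k G S I g → (splitSet I f).card ≤ (splitSet I g).card

/-- Send both half-edges of every `v ∈ C` to `σ v`. -/
def switch (f : V → Fin 2 → V) (C : Finset V) (σ : V → V) : V → Fin 2 → V :=
  fun v j => if v ∈ C then σ v else f v j

variable {k : ℕ} {G : SimpleGraph V} {S I C : Finset V} {f : V → Fin 2 → V} {σ : V → V}

lemma load_switch (hC : C ⊆ I) (s : V) :
    load I (switch f C σ) s + ∑ v ∈ C, (Finset.univ.filter fun j => f v j = s).card =
      load I f s + 2 * (C.filter fun v => σ v = s).card := by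
  have h1 : load I (switch f C σ) s =
      ∑ v ∈ I \ C, (Finset.univ.filter fun j => f v j = s).card +
        2 * (C.filter fun v => σ v = s).card := by
    rw [load, ← Finset.sum_sdiff hC, Finset.card_filter, Finset.mul_sum]
    congr 1
    · refine Finset.sum_congr rfl fun v hv => ?_
      simp [switch, (Finset.mem_sdiff.1 hv).2]
    · refine Finset.sum_congr rfl fun v hv => ?_
      by_cases h : σ v = s <;> simp [switch, hv, h]
  rw [h1, load, ← Finset.sum_sdiff hC]
  ring

lemma card_splitSet_switch_lt (hC : C ⊆ splitSet I f) (hne : C.Nonempty) :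
    (splitSet I (switch f C σ)).card < (splitSet I f).card := by
  refine Finset.card_lt_card ?_
  obtain ⟨c, hc⟩ := hne
  rw [Finset.ssubset_iff_of_subset]
  · refine ⟨c, hC hc, ?_⟩
    rw [splitSet, Finset.mem_filter]
    simp [switch, hc]
  · intro v hv
    rw [splitSet, Finset.mem_filter] at hv ⊢
    refine ⟨hv.1, ?_⟩
    by_cases h : v ∈ C
    · simp [switch, h] at hv
    · simpa [switch, h] using hv.2

/-- Merging the half-edges of split vertices lowers the number of split vertices, so by minimality
it must violate a load bound. -/
lemma IsMinHalfAssignment.exists_load (hf : IsMinHalfAssignment k G S I f)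
    (hC : C ⊆ splitSet I f) (hne : C.Nonempty) (hσ : ∀ v ∈ C, σ v ∈ S ∧ G.Adj v (σ v)) :
    ∃ s ∈ S, load I (switch f C σ) s < 2 * k ∨ 2 * k + 1 < load I (switch f C σ) s := by
  by_contra! h
  refine absurd (hf.2 (switch f C σ) ⟨hf.1.disj, fun v hv j => ?_, fun v hv j => ?_,
    fun s hs => (h s hs).1, fun s hs => (h s hs).2⟩) (not_le.2 (card_splitSet_switch_lt hC hne))
  · by_cases hvC : v ∈ C
    · simpa [switch, hvC] using (hσ v hvC).1
    · simpa [switch, hvC] using hf.1.mem v hv j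
  · by_cases hvC : v ∈ C
    · simpa [switch, hvC] using (hσ v hvC).2
    · simpa [switch, hvC] using hf.1.adj v hv j

lemma card_filter_fin_two (g : Fin 2 → V) (s : V) : (Finset.univ.filter fun j => g j = s).card =
    (if g 0 = s then 1 else 0) + (if g 1 = s then 1 else 0) := by
  rw [Finset.card_filter, Fin.sum_univ_two]

/-- If the ends of `b` had loads `2k+1` and `2k`, moving one half-edge to the lighter end would
exchange these loads and unsplit `b`. -/
lemma IsMinHalfAssignment.load_le_load (hf : IsMinHalfAssignment k G S I f) {b : V} (hb : b ∈ I)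
    (i j : Fin 2) : load I f (f b i) ≤ load I f (f b j) := by
  by_contra! hlt
  have hne : f b i ≠ f b j := fun h => by rw [h] at hlt; exact lt_irrefl _ hlt
  have hi := hf.1.load_le _ (hf.1.mem b hb i)
  have hj := hf.1.le_load _ (hf.1.mem b hb j)
  have hsplit : f b 0 ≠ f b 1 := by
    fin_cases i <;> fin_cases j <;> simp_all
    exact fun h => hne h.symm
  obtain ⟨s, hs, h⟩ := hf.exists_load (C := {b}) (σ := fun _ => f b j)
    (by simp [splitSet, hb, hsplit]) (by simp)
    (by simp [hf.1.mem b hb j, hf.1.adj b hb j])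
  have hsw := load_switch (f := f) (C := {b}) (σ := fun _ => f b j) (I := I) (by simpa using hb) s
  rw [Finset.sum_singleton, card_filter_fin_two, Finset.card_filter, Finset.sum_singleton] at hsw
  have h1 := hf.1.load_le s hs
  have h2 := hf.1.le_load s hs
  have h3 : (if f b 0 = s then 1 else 0) + (if f b 1 = s then 1 else 0) =
      (if f b i = s then 1 else 0) + (if f b j = s then 1 else 0) := by
    fin_cases i <;> fin_cases j <;> simp_all [add_comm]
  rw [h3] at hsw
  by_cases his : f b i = s
  · have hjs : f b j ≠ s := fun h => hne (his.trans h.symm)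
    simp only [his, hjs, if_true, if_false] at hsw
    subst his
    omega
  · by_cases hjs : f b j = s
    · simp only [his, hjs, if_true, if_false] at hsw
      subst hjs
      omega
    · simp only [his, hjs, if_false] at hsw
      omega

/-- The graph with the edges `v — f v j` for `v ∈ I`. -/
def assignGraph (I : Finset V) (f : V → Fin 2 → V) : SimpleGraph V where
  Adj u v := (u ∈ I ∧ v ∉ I ∧ ∃ j, f u j = v) ∨ (v ∈ I ∧ u ∉ I ∧ ∃ j, f v j = u)
  symm := ⟨fun _ _ h => h.symm⟩
  loopless := ⟨fun _ h => by rcases h with h | h <;> exact h.2.1 h.1⟩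

lemma IsHalfAssignment.notMem (hf : IsHalfAssignment k G S I f) {s : V} (hs : s ∈ S) : s ∉ I :=
  Finset.disjoint_left.1 hf.disj hs

lemma IsHalfAssignment.assignGraph_adj (hf : IsHalfAssignment k G S I f) {v s : V} (hv : v ∈ I) :
    (assignGraph I f).Adj v s ↔ ∃ j, f v j = s := by
  constructor
  · rintro (h | h)
    exacts [h.2.2, absurd hv h.2.1]
  · rintro ⟨j, rfl⟩
    exact Or.inl ⟨hv, hf.notMem (hf.mem v hv j), j, rfl⟩

lemma IsHalfAssignment.assignGraph_cases (hf : IsHalfAssignment k G S I f) {u v : V}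
    (h : (assignGraph I f).Adj u v) : (u ∈ I ∧ v ∈ S) ∨ (u ∈ S ∧ v ∈ I) := by
  rcases h with ⟨hu, _, j, rfl⟩ | ⟨hv, _, j, rfl⟩
  exacts [Or.inl ⟨hu, hf.mem _ hu j⟩, Or.inr ⟨hf.mem _ hv j, hv⟩]

lemma IsHalfAssignment.assignGraph_le (hf : IsHalfAssignment k G S I f) : assignGraph I f ≤ G := by
  rintro u v (⟨hu, _, j, rfl⟩ | ⟨hv, _, j, rfl⟩)
  exacts [hf.adj _ hu j, (hf.adj _ hv j).symm]

lemma card_le_of_two_regular {α β : Type*} [DecidableEq α] [DecidableEq β]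
    {r : α → β → Prop} [∀ a b, Decidable (r a b)] {P : Finset α} {Q : Finset β}
    (h1 : ∀ v ∈ P, (Q.filter fun s => r v s).card = 2)
    (h2 : ∀ s ∈ Q, (P.filter fun v => r v s).card = 2) {A : Finset α} (hA : A ⊆ P) :
    A.card ≤ {s | s ∈ Q ∧ ∃ v ∈ A, r v s}.ncard := by
  have hN : {s | s ∈ Q ∧ ∃ v ∈ A, r v s} = (Q.filter fun s => ∃ v ∈ A, r v s : Finset β) := by
    ext; simp
  rw [hN, Set.ncard_coe_finset]
  set N := Q.filter fun s => ∃ v ∈ A, r v s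
  have hd := Finset.sum_card_bipartiteAbove_eq_sum_card_bipartiteBelow (s := A) (t := N) r
  simp only [Finset.bipartiteAbove, Finset.bipartiteBelow] at hd
  have hl : ∑ a ∈ A, (N.filter fun s => r a s).card = A.card * 2 := by
    refine Finset.sum_const_nat fun a ha => ?_
    rw [← h1 a (hA ha)]
    congr 1
    ext s
    simp only [N, Finset.mem_filter]
    exact ⟨fun h => ⟨h.1.1, h.2⟩, fun h => ⟨⟨h.1, a, ha, h.2⟩, h.2⟩⟩
  have hr : ∑ s ∈ N, (A.filter fun v => r v s).card ≤ N.card * 2 := by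
    refine Finset.sum_le_card_nsmul _ _ 2 fun s hs => ?_
    rw [← h2 s (Finset.mem_filter.1 hs).1]
    exact Finset.card_le_card (Finset.filter_subset_filter _ hA)
  omega

/-- On a cycle, choose a perfect matching and send both half-edges of each vertex of `I` to its
partner. Every `s` on the cycle loses two half-edges and gains two, so the loads are unchanged while
split vertices disappear. -/
lemma IsMinHalfAssignment.isAcyclic [Fintype V] (hf : IsMinHalfAssignment k G S I f) :
    (assignGraph I f).IsAcyclic := by
  classical
  intro u p hp
  set M := p.toSubgraph with hM
  have hdeg : ∀ v ∈ p.support, (M.neighborSet v).ncard = 2 := fun v hv =>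
    hp.ncard_neighborSet_toSubgraph_eq_two hv
  have hsupp : ∀ v w, M.Adj v w → v ∈ p.support := fun v w h =>
    p.mem_verts_toSubgraph.1 (M.edge_vert h)
  let P := I.filter (· ∈ p.support)
  let Q := S.filter (· ∈ p.support)
  have hP2 : ∀ v ∈ P, (Q.filter fun s => M.Adj v s).card = 2 := by
    intro v hv
    obtain ⟨hvI, hvp⟩ := Finset.mem_filter.1 hv
    rw [← hdeg v hvp, ← Set.ncard_coe_finset]
    congr 1
    ext s
    simp only [Finset.coe_filter, Set.mem_ofPred_eq, SimpleGraph.Subgraph.mem_neighborSet, Q,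
      Finset.mem_filter]
    refine ⟨fun h => h.2, fun h => ⟨⟨?_, hsupp _ _ h.symm⟩, h⟩⟩
    rcases hf.1.assignGraph_cases (M.adj_sub h) with h' | h'
    · exact h'.2
    · exact absurd hvI (hf.1.notMem h'.1)
  have hQ2 : ∀ s ∈ Q, (P.filter fun v => M.Adj v s).card = 2 := by
    intro s hs
    obtain ⟨hsS, hsp⟩ := Finset.mem_filter.1 hs
    rw [← hdeg s hsp, ← Set.ncard_coe_finset]
    congr 1
    ext v
    simp only [Finset.coe_filter, Set.mem_ofPred_eq, SimpleGraph.Subgraph.mem_neighborSet, P,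
      Finset.mem_filter]
    refine ⟨fun h => h.2.symm, fun h => ⟨⟨?_, hsupp _ _ h.symm⟩, h.symm⟩⟩
    rcases hf.1.assignGraph_cases (M.adj_sub h) with h' | h'
    · exact absurd h'.1 (hf.1.notMem hsS)
    · exact h'.2
  obtain ⟨g, hg, hgl⟩ := exists_assignment (p := 1) (lo := 1) (hi := 1) M.Adj P Q le_rfl
    (fun A hA => by simpa using card_le_of_two_regular hP2 hQ2 hA)
    (fun A hA => by
      have := card_le_of_two_regular (r := fun s v => M.Adj v s) hQ2 hP2 hA
      simpa using this)
  have hgc : ∀ s ∈ Q, (P.filter fun v => g v 0 = s).card = 1 := by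
    intro s hs
    have := hgl s hs
    have h1 : load P g s = (P.filter fun v => g v 0 = s).card := by
      rw [load, Finset.card_filter]
      refine Finset.sum_congr rfl fun v _ => ?_
      by_cases h : g v 0 = s <;> simp [h, Finset.filter_singleton]
    omega
  -- The two cycle edges at `v` exhaust its at most two assigned ends.
  have hMf : ∀ v ∈ P, ∀ s, M.Adj v s ↔ ∃ j, f v j = s := by
    intro v hv s
    have hvI := (Finset.mem_filter.1 hv).1
    have h2 := hdeg v (Finset.mem_filter.1 hv).2
    have hsub : M.neighborSet v ⊆ ((Finset.univ.image (f v) : Finset V) : Set V) := by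
      intro x hx
      simpa using (hf.1.assignGraph_adj hvI).1 (M.adj_sub hx)
    have heq := Set.eq_of_subset_of_ncard_le hsub (by
      rw [h2, Set.ncard_coe_finset]
      exact Finset.card_image_le.trans (by simp))
    have : s ∈ M.neighborSet v ↔ s ∈ ((Finset.univ.image (f v) : Finset V) : Set V) := by rw [heq]
    simpa using this
  have hPsplit : P ⊆ splitSet I f := by
    intro v hv
    refine Finset.mem_filter.2 ⟨(Finset.mem_filter.1 hv).1, fun h => ?_⟩
    have h2 := hP2 v hv
    have : (Q.filter fun s => M.Adj v s) ⊆ {f v 0} := by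
      intro s hs
      obtain ⟨j, rfl⟩ := (hMf v hv s).1 (Finset.mem_filter.1 hs).2
      fin_cases j <;> simp [h]
    have := Finset.card_le_card this
    simp at this
    omega
  have hPne : P.Nonempty := by
    have hu : u ∈ p.support := p.start_mem_support
    obtain ⟨w, hw⟩ : (M.neighborSet u).Nonempty := by
      rw [← Set.ncard_pos, hdeg u hu]
      omega
    rcases hf.1.assignGraph_cases (M.adj_sub hw) with h | h
    · exact ⟨u, Finset.mem_filter.2 ⟨h.1, hu⟩⟩
    · exact ⟨w, Finset.mem_filter.2 ⟨h.2, hsupp _ _ (SimpleGraph.Subgraph.Adj.symm hw)⟩⟩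
  obtain ⟨s, hs, hbad⟩ := hf.exists_load (σ := fun v => g v 0) hPsplit hPne (fun v hv => by
    have := hg v hv 0
    exact ⟨(Finset.mem_filter.1 this.1).1, hf.1.assignGraph_le (M.adj_sub this.2)⟩)
  have hsw := load_switch (f := f) (C := P) (σ := fun v => g v 0) (I := I)
    (Finset.filter_subset _ _) s
  have h1 := hf.1.load_le s hs
  have h2 := hf.1.le_load s hs
  have hsum : ∑ v ∈ P, (Finset.univ.filter fun j => f v j = s).card =
      (P.filter fun v => M.Adj v s).card := by
    rw [Finset.card_filter]
    refine Finset.sum_congr rfl fun v hv => ?_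
    have hne := (Finset.mem_filter.1 (hPsplit hv)).2
    rw [card_filter_fin_two, hMf v hv s]
    by_cases h0 : f v 0 = s
    · have h1 : f v 1 ≠ s := fun h => hne (h0.trans h.symm)
      simp [h0, h1]
    · by_cases h1 : f v 1 = s <;> simp [h0, h1]
  by_cases hsQ : s ∈ Q
  · rw [hsum, hQ2 s hsQ, hgc s hsQ] at hsw
    omega
  · have hz : (P.filter fun v => g v 0 = s).card = 0 := by
      rw [Finset.card_eq_zero, Finset.filter_eq_empty_iff]
      rintro v hv rfl
      exact hsQ (hg v hv 0).1
    have hz' : (P.filter fun v => M.Adj v s).card = 0 := by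
      rw [Finset.card_eq_zero, Finset.filter_eq_empty_iff]
      intro v hv h
      exact hsQ (Finset.mem_filter.2 ⟨hs, hsupp _ _ h.symm⟩)
    rw [hsum, hz, hz'] at hsw
    omega

end HalfAssignment

/-! ### Components of a minimal half-edge assignment -/

section HalfAssignmentComponents

variable {V : Type u} [Fintype V] [DecidableEq V] {k : ℕ} {G : SimpleGraph V} {S I : Finset V}
  {f : V → Fin 2 → V}

open Classical in
lemma IsHalfAssignment.degree_eq (hf : IsHalfAssignment k G S I f) {v : V} (hv : v ∈ I) :
    (assignGraph I f).degree v = if f v 0 = f v 1 then 1 else 2 := by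
  have h : (assignGraph I f).neighborFinset v = {f v 0, f v 1} := by
    ext s
    rw [SimpleGraph.mem_neighborFinset, hf.assignGraph_adj hv]
    simp [Fin.exists_fin_two, eq_comm]
  rw [← SimpleGraph.card_neighborFinset_eq_degree, h]
  split_ifs with h
  · simp [h]
  · exact Finset.card_pair h

open Classical in
lemma IsHalfAssignment.load_eq (hf : IsHalfAssignment k G S I f) {s : V} (hs : s ∈ S) :
    2 * (Finset.univ.filter fun i => (assignGraph I f).Adj s i ∧
        (assignGraph I f).degree i = 1).card +
      (Finset.univ.filter fun i => (assignGraph I f).Adj s i ∧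
        (assignGraph I f).degree i = 2).card = load I f s := by
  have hsub : ∀ d, (Finset.univ.filter fun i => (assignGraph I f).Adj s i ∧
        (assignGraph I f).degree i = d) = I.filter fun i => (assignGraph I f).Adj s i ∧
        (assignGraph I f).degree i = d := by
    intro d
    ext i
    simp only [Finset.mem_filter, Finset.mem_univ, true_and]
    refine ⟨fun h => ⟨?_, h⟩, fun h => h.2⟩
    rcases hf.assignGraph_cases h.1 with h' | h'
    · exact absurd h'.1 (hf.notMem hs)
    · exact h'.2
  rw [hsub, hsub, Finset.card_filter, Finset.card_filter, load, Finset.mul_sum,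
    ← Finset.sum_add_distrib]
  refine Finset.sum_congr rfl fun v hv => ?_
  rw [card_filter_fin_two, hf.degree_eq hv, SimpleGraph.adj_comm, hf.assignGraph_adj hv,
    Fin.exists_fin_two]
  by_cases h0 : f v 0 = s <;> by_cases h1 : f v 1 = s
  · simp [h0, h1]
  · simp [h0, h1, Ne.symm h1]
  · simp [h0, h1]
  · simp [h0, h1]

-- The component is a tree of constant load. Load `2k` forces even numbers of split neighbours,
-- hence none, and the tree is a star with `k` leaves; load `2k+1` is the saturation condition for
-- `𝒯(2k+1)`.
open Classical in
lemma IsMinHalfAssignment.isPiece (hf : IsMinHalfAssignment k G S I f) (hk : 2 ≤ k) {s : V}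
    (hs : s ∈ S) : IsPiece k G ((assignGraph I f).connectedComponentMk s).supp := by
  set F := assignGraph I f with hF
  set c := F.connectedComponentMk s with hc
  have hsc : s ∈ c.supp := rfl
  have hclosed : ∀ u v, F.Adj u v → u ∈ c.supp → v ∈ c.supp := fun u v h hu =>
    (SimpleGraph.ConnectedComponent.mem_supp_congr_adj c h).1 hu
  obtain ⟨H, hH⟩ : ∃ H, H = F.induce c.supp := ⟨_, rfl⟩
  have hadj : ∀ x y, H.Adj x y ↔ F.Adj x.1 y.1 := fun x y => by rw [hH]; rfl
  have hT : H.IsTree := hH ▸ hf.isAcyclic.isTree_connectedComponent c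
  let S' : Finset ↥c.supp := Finset.univ.filter fun x => x.1 ∈ S
  have hmemI : ∀ x : ↥c.supp, x ∈ S' ∨ x.1 ∈ I := by
    have := forall_of_preconnected hT.connected.preconnected
      (P := fun x : ↥c.supp => x ∈ S' ∨ x.1 ∈ I) (fun u v huv _ => by
        rcases hf.1.assignGraph_cases ((hadj u v).1 huv) with h | h
        · exact Or.inl (by simp [S', h.2])
        · exact Or.inr h.2) (u := ⟨s, hsc⟩) (Or.inl (by simp [S', hs]))
    exact this
  have hS' : ∀ x : ↥c.supp, x ∉ S' ↔ x.1 ∈ I := fun x =>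
    ⟨(hmemI x).resolve_left, fun h hx => hf.1.notMem (by simpa [S'] using hx) h⟩
  have hbip : H.IsBipartiteWith S' ↑(S'ᶜ) := by
    refine ⟨?_, fun u v huv => ?_⟩
    · rw [Finset.disjoint_coe]
      exact disjoint_compl_right
    · simp only [Finset.mem_coe, Finset.mem_compl, hS']
      rcases hf.1.assignGraph_cases ((hadj u v).1 huv) with h | h
      · exact Or.inr ⟨h.1, by simp [S', h.2]⟩
      · exact Or.inl ⟨by simp [S', h.1], h.2⟩
  have hdegF : ∀ x : ↥c.supp, H.degree x = F.degree x.1 := by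
    intro x
    rw [← SimpleGraph.card_neighborFinset_eq_degree, ← SimpleGraph.card_neighborFinset_eq_degree,
      ← Finset.card_map (Function.Embedding.subtype _)]
    congr 1
    ext y
    simp only [Finset.mem_map, SimpleGraph.mem_neighborFinset, hadj,
      Function.Embedding.subtype_apply]
    exact ⟨fun ⟨z, hz, h⟩ => h ▸ hz, fun h => ⟨⟨y, hclosed _ _ h x.2⟩, h, rfl⟩⟩
  have hdeg : ∀ i ∉ S', H.degree i = 1 ∨ H.degree i = 2 := by
    intro i hi
    have := hf.1.degree_eq ((hS' i).1 hi)
    rw [← hdegF i] at this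
    rw [this]
    split_ifs <;> simp
  have hcount : ∀ (x : ↥c.supp) (d : ℕ),
      (Finset.univ.filter fun i => H.Adj x i ∧ H.degree i = d).card =
        (Finset.univ.filter fun i => F.Adj x.1 i ∧ F.degree i = d).card := by
    intro x d
    rw [← Finset.card_map (Function.Embedding.subtype _)]
    congr 1
    ext y
    simp only [Finset.mem_map, Finset.mem_filter, Finset.mem_univ, true_and, hadj, hdegF,
      Function.Embedding.subtype_apply]
    exact ⟨fun ⟨z, hz, h⟩ => h ▸ hz, fun h => ⟨⟨y, hclosed _ _ h.1 x.2⟩, h, rfl⟩⟩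
  have hloadH : ∀ x ∈ S', 2 * (Finset.univ.filter fun i => H.Adj x i ∧ H.degree i = 1).card +
      (Finset.univ.filter fun i => H.Adj x i ∧ H.degree i = 2).card = load I f x.1 := by
    intro x hx
    rw [hcount, hcount]
    exact hf.1.load_eq (by simpa [S'] using hx)
  have hconst : ∀ x ∈ S', load I f x.1 = load I f s := by
    -- The property also speaks of both ends of a vertex of `I`, so that it propagates along single
    -- edges.
    have key := forall_of_preconnected hT.connected.preconnected
      (P := fun x : ↥c.supp => (x.1 ∈ S → load I f x.1 = load I f s) ∧
        (x.1 ∈ I → ∀ j, load I f (f x.1 j) = load I f s)) (fun u v huv hu => by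
          rcases hf.1.assignGraph_cases ((hadj u v).1 huv) with h | h
          · obtain ⟨j, hj⟩ := (hf.1.assignGraph_adj h.1).1 ((hadj u v).1 huv)
            exact ⟨fun _ => hj ▸ hu.2 h.1 j, fun hI => absurd hI (hf.1.notMem h.2)⟩
          · obtain ⟨j, hj⟩ := (hf.1.assignGraph_adj h.2).1 ((hadj u v).1 huv).symm
            refine ⟨fun hS => absurd h.2 (hf.1.notMem hS), fun _ i => ?_⟩
            rw [← hu.1 h.1, ← hj]
            exact le_antisymm (hf.load_le_load h.2 _ _) (hf.load_le_load h.2 _ _))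
      (u := ⟨s, hsc⟩) ⟨fun _ => rfl, fun hI => absurd hI (hf.1.notMem hs)⟩
    exact fun x hx => (key x).1 (by simpa [S'] using hx)
  have h1 := hf.1.le_load s hs
  have h2 := hf.1.load_le s hs
  rcases (by omega : load I f s = 2 * k ∨ load I f s = 2 * k + 1) with hL | hL
  · have hempty := deg2_eq_empty_of_even hT hbip hdeg (fun x hx => by
      have hx' := hloadH x hx
      rw [hconst x hx, hL] at hx'
      have : ((deg2 H S').filter fun i => H.Adj x i) =
          Finset.univ.filter fun i => H.Adj x i ∧ H.degree i = 2 := by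
        ext i
        simp only [Finset.mem_filter, Finset.mem_compl, Finset.mem_univ, true_and]
        exact ⟨fun h => ⟨h.2, h.1.2⟩, fun h => ⟨⟨notMem_of_adj_of_mem hbip h.1 hx, h.2⟩, h.1⟩⟩
      rw [this, Nat.even_iff]
      omega)
    have hcard := card_eq_card_deg2_add_one hT hbip hdeg
    rw [hempty, Finset.card_empty, zero_add, Finset.card_eq_one] at hcard
    obtain ⟨t, ht⟩ := hcard
    have hone : ∀ x ∈ c.supp, x ∈ S → x = s := by
      intro x hx hxS
      have e1 : (⟨x, hx⟩ : ↥c.supp) ∈ S' := by simp [S', hxS]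
      have e2 : (⟨s, hsc⟩ : ↥c.supp) ∈ S' := by simp [S', hs]
      rw [ht, Finset.mem_singleton] at e1 e2
      exact congrArg Subtype.val (e1.trans e2.symm)
    have hto : ∀ v ∈ I, v ∈ c.supp → ∀ j, f v j = s := fun v hv hvc j =>
      hone _ (hclosed v _ ((hf.1.assignGraph_adj hv).2 ⟨j, rfl⟩) hvc) (hf.1.mem v hv j)
    have hfrom : ∀ v ∈ I, ∀ j, f v j = s → v ∈ c.supp := fun v hv j hj =>
      hclosed s v ((hf.1.assignGraph_adj hv).2 ⟨j, hj⟩).symm hsc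
    let L := I.filter fun v => f v 0 = s
    have hsupp : c.supp = insert s (L : Set V) := by
      ext x
      simp only [Set.mem_insert_iff, Finset.mem_coe, L, Finset.mem_filter]
      constructor
      · intro hx
        by_cases hxI : x ∈ I
        · exact Or.inr ⟨hxI, hto x hxI hx 0⟩
        · refine Or.inl (hone x hx ?_)
          have := (hmemI ⟨x, hx⟩).resolve_right hxI
          simpa [S'] using this
      · rintro (rfl | ⟨hxI, hx⟩)
        exacts [hsc, hfrom x hxI 0 hx]
    have hloadL : load I f s = L.card * 2 := by
      rw [load, Finset.card_filter, Finset.sum_mul]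
      refine Finset.sum_congr rfl fun v hv => ?_
      rw [card_filter_fin_two]
      by_cases hvc : v ∈ c.supp
      · simp [hto v hv hvc]
      · have h0 : ∀ j, f v j ≠ s := fun j hj => hvc (hfrom v hv j hj)
        simp [h0]
    rw [hsupp]
    refine isPiece_star ?_ (by omega) fun v hv => ?_
    · rw [← Finset.card_pos]
      omega
    · obtain ⟨hvI, hv⟩ := Finset.mem_filter.1 hv
      exact hv ▸ (hf.1.adj v hvI 0).symm
  · refine ⟨F, hf.1.assignGraph_le, hH ▸ hT.connected, Or.inr (hH ▸ ?_)⟩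
    exact isInT_of_isTree hk hT hbip hdeg fun x hx => by rw [hloadH x hx, hconst x hx, hL]

lemma IsMinHalfAssignment.coverable (hf : IsMinHalfAssignment k G S I f) (hk : 2 ≤ k) :
    Coverable k G ((S ∪ I : Finset V) : Set V) := by
  have hu : ((S ∪ I : Finset V) : Set V) =
      ⋃ s : ↥S, ((assignGraph I f).connectedComponentMk s.1).supp := by
    ext x
    simp only [Finset.coe_union, Set.mem_union, Finset.mem_coe, Set.mem_iUnion]
    constructor
    · rintro (h | h)
      · exact ⟨⟨x, h⟩, rfl⟩
      · refine ⟨⟨f x 0, hf.1.mem x h 0⟩, ?_⟩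
        exact SimpleGraph.ConnectedComponent.eq.2
          (SimpleGraph.Adj.reachable ((hf.1.assignGraph_adj h).2 ⟨0, rfl⟩))
    · rintro ⟨s, hx⟩
      obtain ⟨p⟩ := SimpleGraph.ConnectedComponent.eq.1 hx
      cases p with
      | nil => exact Or.inl s.2
      | cons h _ =>
        rcases hf.1.assignGraph_cases h with h | h
        exacts [Or.inr h.1, Or.inl h.1]
  rw [hu]
  refine coverable_iUnion (fun s => hf.isPiece hk s.2) ?_
  rintro s t ⟨x, hx, hx'⟩
  rw [SimpleGraph.ConnectedComponent.mem_supp_iff] at hx hx'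
  rw [← hx, ← hx']

end HalfAssignmentComponents

/-! ### Assembling the factor -/

section Main

variable {V : Type u} [Fintype V] [DecidableEq V] {G : SimpleGraph V} [DecidableRel G.Adj] {k : ℕ}

/-- The sufficiency part of the theorem of Kano and Saito. -/
lemma hasStarTreeFactor_of_card_isol_le (hk : 2 ≤ k)
    (h : ∀ T : Finset V, 2 * (isol G Finset.univ T).card ≤ (2 * k + 1) * T.card) :
    HasStarTreeFactor k G := by
  obtain ⟨S, hS⟩ := exists_isMaxDeficient (G := G) k Finset.univ
  set I := isol G Finset.univ S with hI
  -- The upper bound `2k+1` comes from the isolated-vertex hypothesis, the lower bound `2k` from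
  -- maximality with constant `k`.
  obtain ⟨f₀, hf₀, hl₀⟩ := exists_assignment (p := 2) (lo := 2 * k) (hi := 2 * k + 1) G.Adj I S
    (by omega) (fun A hA => mul_card_le_of_subset_isol hS.1 (fun T _ => h T) hA)
    (fun T hT => by
      rw [mul_assoc]
      exact Nat.mul_le_mul_left 2 (hS.mul_card_le hT))
  have hex : ∃ f, IsHalfAssignment k G S I f :=
    ⟨f₀, disjoint_isol _ _, fun v hv j => (hf₀ v hv j).1, fun v hv j => (hf₀ v hv j).2,
      fun s hs => (hl₀ s hs).1, fun s hs => (hl₀ s hs).2⟩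
  obtain ⟨f, hf, hmin⟩ : ∃ f, IsHalfAssignment k G S I f ∧
      ∀ g, IsHalfAssignment k G S I g → (splitSet I f).card ≤ (splitSet I g).card := by
    obtain ⟨f, hf⟩ := exists_minimalFor_of_wellFoundedLT (IsHalfAssignment k G S I)
      (fun f => (splitSet I f).card) hex
    exact ⟨f, hf.1, fun g hg => (le_total _ _).elim id fun h' => hf.2 hg h'⟩
  have h1 : Coverable k G ((S ∪ I : Finset V) : Set V) :=
    IsMinHalfAssignment.coverable ⟨hf, hmin⟩ hk
  have h2 := coverable_of_card_isol_le (G := G) hk (D := Finset.univ \ (S ∪ I))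
    (fun T hT => hS.card_isol_sdiff_le hT)
  have := h1.union h2 (by exact_mod_cast Finset.disjoint_sdiff)
  rw [← Finset.coe_union, Finset.union_sdiff_of_subset (Finset.subset_univ _),
    Finset.coe_univ] at this
  exact this.hasStarTreeFactor

end Main

end StarTreeFactor

theorem theorem1p2 {V : Type*} [Fintype V] [DecidableEq V] (G : SimpleGraph V)
    [DecidableRel G.Adj] (k n : ℕ) (hk : 2 ≤ k) (hn : Fintype.card V = n) (hn2 : 2 ≤ n)
    (hG : ∃ a b : V, G.Adj a b)
    (hμ : StarTreeFactor.lapEigenvalue G ⟨1 - 1, by omega⟩ ≤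
      ((k : ℝ) + 1 / 2) * StarTreeFactor.lapEigenvalue G ⟨(n - 1) - 1, by omega⟩) :
    StarTreeFactor.HasStarTreeFactor k G := by
  have hdeg := StarTreeFactor.two_mul_degree_le G hn hn2 hG hμ
  refine StarTreeFactor.hasStarTreeFactor_of_card_isol_le hk
    (StarTreeFactor.two_mul_card_isol_le (fun v => ?_) hdeg)
  obtain ⟨a, b, hab⟩ := hG
  have ha : 0 < G.degree a := (G.degree_pos_iff_exists_adj a).2 ⟨b, hab⟩
  -- An isolated `v` would force `deg a = 0`, against the edge `ab`.
  have := hdeg a v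
  by_contra h0
  rw [Nat.eq_zero_of_not_pos h0] at this
  omega
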